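/- Let $k$ be a field. For a right comodule $M$ over a $k$-coalgebra $C$, say that $M$ is quasi-finite if $\mathrm{Hom}_C(S,M)$ is finite-dimensional over $k$ for every simple right $C$-comodule $S$, and strictly quasi-finite if $M/M'$ is quasi-finite for every subcomodule $M'\subseteq M$. A coalgebra $C$ is right strictly quasi-finite if it is strictly quasi-finite as a right comodule over itself, and right semiperfect if every simple right $C$-comodule has a projective cover. Coalgebras $C$ and $D$ are Morita–Takeuchi equivalent if there is a $k$-linear equivalence between their categories of right comodules. For subspaces $X,Y\subseteq C$ put $X\wedge Y=\Delta^{-1}(X\otimes C+C\otimes Y)$, and put $\bigwedge^1 A=A$, $\bigwedge^{n+1}A=(\bigwedge^n A)\wedge A$. Then: (1) Every subcoalgebra of a right strictly quasi-finite coalgebra is right strictly quasi-finite. (2) Let $A$ be a finite-dimensional subcoalgebra of a coalgebra $C$ and let $A_\infty=\bigcup_{n\ge 1}\bigwedge^n A$, a subcoalgebra of $C$. If $C$ is right strictly quasi-finite, then $A_\infty$ is artinian as a right comodule (its subcomodules satisfy the descending chain condition). If $C$ is right semiperfect, then $A_\infty$ is finite-dimensional. (3) If $C$ is a right strictly quasi-finite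 coalgebra and $D$ is a coalgebra Morita–Takeuchi equivalent to $C$, then $D$ is right strictly quasi-finite. (4) The direct sum of any family of right strictly quasi-finite coalgebras is right strictly quasi-finite. -/

import Mathlib

open TensorProduct CategoryTheory

universe u

/-! ### Right comodules, their morphisms, subcomodules and factor comodules -/

/-- A right comodule structure over the coalgebra `C` on the `k`-module `M`: a coaction
`ρ : M → M ⊗ C` which is coassociative and counital. -/
class RightComodule (k C M : Type*) [Field k] [AddCommGroup C] [Module k C] [Coalgebra k C]
    [AddCommGroup M] [Module k M] where
  coact : M →ₗ[k] M ⊗[k] C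
  coassoc : (TensorProduct.assoc k M C C).toLinearMap ∘ₗ coact.rTensor C ∘ₗ coact =
    (Coalgebra.comul (R := k) (A := C)).lTensor M ∘ₗ coact
  lTensor_counit_comp_coact : (Coalgebra.counit (R := k) (A := C)).lTensor M ∘ₗ coact =
    (TensorProduct.mk k M k).flip 1

/-- The coalgebra `C` as a right comodule over itself, through its comultiplication. -/
instance RightComodule.regular (k C : Type*) [Field k] [AddCommGroup C] [Module k C]
    [Coalgebra k C] : RightComodule k C C where
  coact := Coalgebra.comul
  coassoc := Coalgebra.coassoc
  lTensor_counit_comp_coact := Coalgebra.lTensor_counit_comp_comul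

/-- The `k`-vector space of morphisms of right `C`-comodules from `M` to `N`. -/
def comodHom (k C M N : Type*) [Field k] [AddCommGroup C] [Module k C] [Coalgebra k C]
    [AddCommGroup M] [Module k M] [RightComodule k C M]
    [AddCommGroup N] [Module k N] [RightComodule k C N] : Submodule k (M →ₗ[k] N) where
  carrier := {f | RightComodule.coact (C := C) ∘ₗ f =
    f.rTensor C ∘ₗ RightComodule.coact (k := k)}
  zero_mem' := by simp
  add_mem' := by
    intro f g hf hg
    change _ = _ at hf hg
    change _ = _
    rw [LinearMap.comp_add, hf, hg, LinearMap.rTensor_add, LinearMap.add_comp]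
  smul_mem' := by
    intro c f hf
    change _ = _ at hf
    change _ = _
    rw [LinearMap.comp_smul, hf, LinearMap.rTensor_smul, LinearMap.smul_comp]

/-- A subcomodule of a right comodule `M`: a subspace `N` with `ρ(N) ⊆ N ⊗ C`. -/
structure Subcomodule (k C M : Type*) [Field k] [AddCommGroup C] [Module k C] [Coalgebra k C]
    [AddCommGroup M] [Module k M] [RightComodule k C M] extends Submodule k M where
  coact_mem : ∀ m ∈ toSubmodule, RightComodule.coact (k := k) (C := C) m ∈
    LinearMap.range (toSubmodule.subtype.rTensor C)

theorem Subcomodule.toSubmodule_injective (k C M : Type*) [Field k] [AddCommGroup C]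
    [Module k C] [Coalgebra k C] [AddCommGroup M] [Module k M] [RightComodule k C M] :
    Function.Injective (Subcomodule.toSubmodule : Subcomodule k C M → Submodule k M) := by
  rintro ⟨N, _⟩ ⟨N', _⟩ h
  cases h
  rfl

/-- Subcomodules are ordered by inclusion. -/
instance Subcomodule.instPartialOrder (k C M : Type*) [Field k] [AddCommGroup C] [Module k C]
    [Coalgebra k C] [AddCommGroup M] [Module k M] [RightComodule k C M] :
    PartialOrder (Subcomodule k C M) :=
  PartialOrder.lift Subcomodule.toSubmodule (Subcomodule.toSubmodule_injective k C M)

theorem Subcomodule.le_ker_mkQ_coact {k C M : Type*} [Field k] [AddCommGroup C] [Module k C]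
    [Coalgebra k C] [AddCommGroup M] [Module k M] [RightComodule k C M]
    (N : Subcomodule k C M) : N.toSubmodule ≤
      LinearMap.ker (N.toSubmodule.mkQ.rTensor C ∘ₗ RightComodule.coact (k := k) (C := C)) := by
  intro m hm
  obtain ⟨t, ht⟩ := N.coact_mem m hm
  rw [LinearMap.mem_ker, LinearMap.comp_apply, ← ht, ← LinearMap.comp_apply, ← LinearMap.rTensor_comp]
  have h : N.toSubmodule.mkQ ∘ₗ N.toSubmodule.subtype = 0 := by
    ext x
    simp
  rw [h]
  simp

/-- The factor comodule `M / N`. -/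
instance RightComodule.quotient {k C M : Type*} [Field k] [AddCommGroup C] [Module k C]
    [Coalgebra k C] [AddCommGroup M] [Module k M] [RightComodule k C M]
    (N : Subcomodule k C M) : RightComodule k C (M ⧸ N.toSubmodule) where
  coact := N.toSubmodule.liftQ (N.toSubmodule.mkQ.rTensor C ∘ₗ RightComodule.coact) N.le_ker_mkQ_coact
  coassoc := by
    apply Submodule.linearMap_qext
    simp only [LinearMap.comp_assoc, Submodule.liftQ_mkQ]
    rw [← LinearMap.comp_assoc (RightComodule.coact) (N.toSubmodule.mkQ.rTensor C),
      ← LinearMap.rTensor_comp, Submodule.liftQ_mkQ,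
      ← LinearMap.comp_assoc (RightComodule.coact) (N.toSubmodule.mkQ.rTensor C),
      LinearMap.lTensor_comp_rTensor, ← LinearMap.rTensor_comp_lTensor, LinearMap.comp_assoc,
      ← RightComodule.coassoc, LinearMap.rTensor_comp]
    simp only [← LinearMap.comp_assoc]
    congr 2
    ext
    simp
  lTensor_counit_comp_coact := by
    apply Submodule.linearMap_qext
    rw [LinearMap.comp_assoc, Submodule.liftQ_mkQ, ← LinearMap.comp_assoc,
      LinearMap.lTensor_comp_rTensor, ← LinearMap.rTensor_comp_lTensor, LinearMap.comp_assoc,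
      RightComodule.lTensor_counit_comp_coact]
    ext m
    simp

/-! ### Finiteness conditions on comodules and coalgebras -/

/-- A simple right comodule: nonzero, with no subcomodules but `0` and itself. -/
def IsSimpleComodule (k C M : Type*) [Field k] [AddCommGroup C] [Module k C] [Coalgebra k C]
    [AddCommGroup M] [Module k M] [RightComodule k C M] : Prop :=
  Nontrivial M ∧ ∀ N : Subcomodule k C M, N.toSubmodule = ⊥ ∨ N.toSubmodule = ⊤

/-- An artinian right comodule: subcomodules satisfy the descending chain condition. -/
def IsArtinianComodule (k C M : Type*) [Field k] [AddCommGroup C] [Module k C] [Coalgebra k C]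
    [AddCommGroup M] [Module k M] [RightComodule k C M] : Prop :=
  WellFoundedLT (Subcomodule k C M)

/-- A right comodule `M` is quasi-finite if `Hom_C(S, M)` is finite-dimensional for every simple
right comodule `S`. -/
def IsQuasiFinite (k C M : Type u) [Field k] [AddCommGroup C] [Module k C] [Coalgebra k C]
    [AddCommGroup M] [Module k M] [RightComodule k C M] : Prop :=
  ∀ (S : Type u) [AddCommGroup S] [Module k S] [RightComodule k C S],
    IsSimpleComodule k C S → Module.Finite k (comodHom k C S M)

/-- A right comodule is strictly quasi-finite if all its factor comodules are quasi-finite. -/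
def IsStrictlyQuasiFinite (k C M : Type u) [Field k] [AddCommGroup C] [Module k C]
    [Coalgebra k C] [AddCommGroup M] [Module k M] [RightComodule k C M] : Prop :=
  ∀ N : Subcomodule k C M, IsQuasiFinite k C (M ⧸ N.toSubmodule)

/-- A coalgebra is right strictly quasi-finite if it is strictly quasi-finite as a right comodule
over itself. -/
def IsRightStrictlyQuasiFinite (k C : Type u) [Field k] [AddCommGroup C] [Module k C]
    [Coalgebra k C] : Prop :=
  IsStrictlyQuasiFinite k C C

/-- A projective right comodule: morphisms out of it lift along surjective morphisms. -/
def IsProjectiveComodule (k C P : Type u) [Field k] [AddCommGroup C] [Module k C]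
    [Coalgebra k C] [AddCommGroup P] [Module k P] [RightComodule k C P] : Prop :=
  ∀ (M N : Type u) [AddCommGroup M] [Module k M] [RightComodule k C M]
    [AddCommGroup N] [Module k N] [RightComodule k C N],
    ∀ g ∈ comodHom k C M N, Function.Surjective g →
      ∀ f ∈ comodHom k C P N, ∃ h ∈ comodHom k C P M, g ∘ₗ h = f

/-- A projective cover of `M`: a surjective morphism `f : P → M` from a projective comodule
whose kernel is small, that is, no proper subcomodule `N` of `P` satisfies
`N + ker f = P`. -/
def IsProjectiveCover (k C : Type u) {P M : Type u} [Field k] [AddCommGroup C] [Module k C]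
    [Coalgebra k C] [AddCommGroup P] [Module k P] [RightComodule k C P]
    [AddCommGroup M] [Module k M] [RightComodule k C M] (f : P →ₗ[k] M) : Prop :=
  IsProjectiveComodule k C P ∧ f ∈ comodHom k C P M ∧ Function.Surjective f ∧
    ∀ N : Subcomodule k C P, N.toSubmodule ⊔ LinearMap.ker f = ⊤ → N.toSubmodule = ⊤

/-- A coalgebra is right semiperfect if every simple right comodule has a projective cover. -/
def IsRightSemiperfect (k C : Type u) [Field k] [AddCommGroup C] [Module k C]
    [Coalgebra k C] : Prop :=
  ∀ (S : Type u) [AddCommGroup S] [Module k S] [RightComodule k C S], IsSimpleComodule k C S →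
    ∃ (P : Type u) (_ : AddCommGroup P) (_ : Module k P) (_ : RightComodule k C P)
      (f : P →ₗ[k] S), IsProjectiveCover k C f

/-! ### The category of right comodules and Morita-Takeuchi equivalence -/

/-- An object of the category of right `C`-comodules. -/
structure ComodCat (k C : Type u) [Field k] [AddCommGroup C] [Module k C] [Coalgebra k C] where
  carrier : Type u
  [addCommGroup : AddCommGroup carrier]
  [module : Module k carrier]
  [comodule : RightComodule k C carrier]

attribute [instance] ComodCat.addCommGroup ComodCat.module ComodCat.comodule

/-- The category of right `C`-comodules, with comodule morphisms. -/
instance ComodCat.instCategory (k C : Type u) [Field k] [AddCommGroup C] [Module k C]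
    [Coalgebra k C] : Category.{u} (ComodCat k C) where
  Hom X Y := comodHom k C X.carrier Y.carrier
  id X := ⟨LinearMap.id, by simp [comodHom]⟩
  comp {X Y Z} f g := ⟨g.1 ∘ₗ f.1, by
    have hf : _ = _ := f.2
    have hg : _ = _ := g.2
    change _ = _
    rw [← LinearMap.comp_assoc, hg, LinearMap.comp_assoc, hf, LinearMap.rTensor_comp,
      LinearMap.comp_assoc]⟩

instance ComodCat.instPreadditive (k C : Type u) [Field k] [AddCommGroup C] [Module k C]
    [Coalgebra k C] : Preadditive (ComodCat k C) where
  homGroup X Y := inferInstanceAs (AddCommGroup (comodHom k C X.carrier Y.carrier))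
  add_comp _ _ _ f f' g := Subtype.ext (LinearMap.comp_add f.1 f'.1 g.1)
  comp_add _ _ _ f g g' := Subtype.ext (LinearMap.add_comp f.1 g'.1 g.1)

instance ComodCat.instLinear (k C : Type u) [Field k] [AddCommGroup C] [Module k C]
    [Coalgebra k C] : CategoryTheory.Linear k (ComodCat k C) where
  homModule X Y := inferInstanceAs (Module k (comodHom k C X.carrier Y.carrier))
  smul_comp _ _ _ r f g := Subtype.ext (LinearMap.comp_smul g.1 r f.1)
  comp_smul _ _ _ f r g := Subtype.ext (LinearMap.smul_comp r g.1 f.1)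

/-- `D` is Morita-Takeuchi equivalent to `C` if there is a `k`-linear equivalence from the
category of right `D`-comodules to the category of right `C`-comodules. -/
def MoritaTakeuchiEquivalent (k D C : Type u) [Field k] [AddCommGroup D] [Module k D]
    [Coalgebra k D] [AddCommGroup C] [Module k C] [Coalgebra k C] : Prop :=
  ∃ e : ComodCat k D ≌ ComodCat k C, e.functor.Linear k

/-! ### Subcoalgebras -/

/-- A subcoalgebra of `C`: a subspace `D` with `Δ(D) ⊆ D ⊗ D`. -/
structure Subcoalgebra (k C : Type*) [Field k] [AddCommGroup C] [Module k C]
    [Coalgebra k C] extends Submodule k C where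
  comul_mem : ∀ c ∈ toSubmodule, Coalgebra.comul (R := k) c ∈
    LinearMap.range (TensorProduct.map toSubmodule.subtype toSubmodule.subtype)

theorem map_subtype_injective {k C : Type*} [Field k] [AddCommGroup C] [Module k C]
    (D : Submodule k C) : Function.Injective (TensorProduct.map D.subtype D.subtype) := by
  rw [← LinearMap.lTensor_comp_rTensor]
  exact (Module.Flat.lTensor_preserves_injective_linearMap _ D.injective_subtype).comp
    (Module.Flat.rTensor_preserves_injective_linearMap _ D.injective_subtype)

/-- A subcoalgebra carries the restricted comultiplication and counit. -/
noncomputable instance Subcoalgebra.instCoalgebraStruct {k C : Type*} [Field k] [AddCommGroup C]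
    [Module k C] [Coalgebra k C] (D : Subcoalgebra k C) :
    CoalgebraStruct k D.toSubmodule where
  comul := (LinearEquiv.ofInjective _ (map_subtype_injective D.toSubmodule)).symm.toLinearMap ∘ₗ
    (Coalgebra.comul (R := k) ∘ₗ D.toSubmodule.subtype).codRestrict _
      (fun c => D.comul_mem c c.2)
  counit := Coalgebra.counit ∘ₗ D.toSubmodule.subtype

theorem Subcoalgebra.map_comp_comul {k C : Type*} [Field k] [AddCommGroup C]
    [Module k C] [Coalgebra k C] (D : Subcoalgebra k C) :
    TensorProduct.map D.toSubmodule.subtype D.toSubmodule.subtype ∘ₗ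
      CoalgebraStruct.comul (R := k) (A := D.toSubmodule) =
    Coalgebra.comul (R := k) (A := C) ∘ₗ D.toSubmodule.subtype := by
  ext c
  have h := (LinearEquiv.ofInjective _ (map_subtype_injective D.toSubmodule)).apply_symm_apply
    ((Coalgebra.comul (R := k) ∘ₗ D.toSubmodule.subtype).codRestrict _
      (fun c => D.comul_mem c c.2) c)
  exact congrArg Subtype.val h

noncomputable instance Subcoalgebra.instCoalgebra {k C : Type*} [Field k] [AddCommGroup C]
    [Module k C] [Coalgebra k C] (D : Subcoalgebra k C) :
    Coalgebra k D.toSubmodule where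
  coassoc := by
    have hD := D.map_comp_comul
    set i := D.toSubmodule.subtype with hi
    have hinj : Function.Injective (TensorProduct.map i (TensorProduct.map i i)) := by
      rw [← LinearMap.lTensor_comp_rTensor]
      exact (Module.Flat.lTensor_preserves_injective_linearMap _
        (map_subtype_injective D.toSubmodule)).comp
        (Module.Flat.rTensor_preserves_injective_linearMap _ D.toSubmodule.injective_subtype)
    apply (LinearMap.cancel_left hinj).1
    have e : TensorProduct.map i (TensorProduct.map i i) ∘ₗ (TensorProduct.assoc k _ _ _).toLinearMap
        = (TensorProduct.assoc k C C C).toLinearMap ∘ₗ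
          TensorProduct.map (TensorProduct.map i i) i := by
      ext
      simp
    have l : TensorProduct.map i (TensorProduct.map i i) ∘ₗ
        (CoalgebraStruct.comul (R := k)).lTensor D.toSubmodule =
        (Coalgebra.comul (R := k)).lTensor C ∘ₗ TensorProduct.map i i := by
      rw [LinearMap.map_comp_lTensor, hD, LinearMap.lTensor_comp_map]
    have r : TensorProduct.map (TensorProduct.map i i) i ∘ₗ
        (CoalgebraStruct.comul (R := k)).rTensor D.toSubmodule =
        (Coalgebra.comul (R := k)).rTensor C ∘ₗ TensorProduct.map i i := by
      rw [LinearMap.map_comp_rTensor, hD, LinearMap.rTensor_comp_map]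
    rw [← LinearMap.comp_assoc, e, LinearMap.comp_assoc, ← LinearMap.comp_assoc _ _
      (TensorProduct.map (TensorProduct.map i i) i), r, LinearMap.comp_assoc, hD,
      ← LinearMap.comp_assoc _ (LinearMap.lTensor _ _), l, LinearMap.comp_assoc, hD,
      ← LinearMap.comp_assoc i, ← LinearMap.comp_assoc i, ← LinearMap.comp_assoc i,
      Coalgebra.coassoc]
  rTensor_counit_comp_comul := by
    have hD := D.map_comp_comul
    set i := D.toSubmodule.subtype with hi
    apply (LinearMap.cancel_left (Module.Flat.lTensor_preserves_injective_linearMap (M := k) _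
      D.toSubmodule.injective_subtype)).1
    change _ ∘ₗ (LinearMap.rTensor _ (Coalgebra.counit (R := k) ∘ₗ i)) ∘ₗ _ = _
    rw [← LinearMap.comp_assoc, LinearMap.lTensor_comp_rTensor, ← LinearMap.rTensor_comp_map,
      LinearMap.comp_assoc, hD, ← LinearMap.comp_assoc, Coalgebra.rTensor_counit_comp_comul]
    rfl
  lTensor_counit_comp_comul := by
    have hD := D.map_comp_comul
    set i := D.toSubmodule.subtype with hi
    apply (LinearMap.cancel_left (Module.Flat.rTensor_preserves_injective_linearMap (M := k) _
      D.toSubmodule.injective_subtype)).1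
    change _ ∘ₗ (LinearMap.lTensor _ (Coalgebra.counit (R := k) ∘ₗ i)) ∘ₗ _ = _
    rw [← LinearMap.comp_assoc, LinearMap.rTensor_comp_lTensor, ← LinearMap.lTensor_comp_map,
      LinearMap.comp_assoc, hD, ← LinearMap.comp_assoc, Coalgebra.lTensor_counit_comp_comul]
    rfl

/-! ### Wedges -/

/-- The wedge `X ∧ Y = Δ⁻¹(X ⊗ C + C ⊗ Y)`, the kernel of `C → C ⊗ C → C/X ⊗ C/Y`. -/
def wedge {k C : Type*} [Field k] [AddCommGroup C] [Module k C] [Coalgebra k C]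
    (X Y : Submodule k C) : Submodule k C :=
  LinearMap.ker (TensorProduct.map X.mkQ Y.mkQ ∘ₗ Coalgebra.comul (R := k))

/-- The wedge powers `⋀ⁿ X`: `⋀⁰ X = 0`, `⋀¹ X = X`, `⋀ⁿ⁺¹ X = (⋀ⁿ X) ∧ X` for `n ≥ 1`. -/
def wedgePow {k C : Type*} [Field k] [AddCommGroup C] [Module k C] [Coalgebra k C]
    (X : Submodule k C) : ℕ → Submodule k C
  | 0 => ⊥
  | 1 => X
  | n + 2 => wedge (wedgePow X (n + 1)) X

/-- A subspace `Z` with `Δ(Z) ⊆ Z ⊗ C` and `Δ(Z) ⊆ C ⊗ Z` satisfies `Δ(Z) ⊆ Z ⊗ Z`. -/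
theorem mem_range_map_subtype {k C : Type*} [Field k] [AddCommGroup C] [Module k C]
    (Z : Submodule k C) (t : C ⊗[k] C) (h₁ : Z.mkQ.rTensor C t = 0)
    (h₂ : Z.mkQ.lTensor C t = 0) :
    t ∈ LinearMap.range (TensorProduct.map Z.subtype Z.subtype) := by
  have e₁ := rTensor_exact C (LinearMap.exact_subtype_mkQ Z) Z.mkQ_surjective
  have e₂ := lTensor_exact Z (LinearMap.exact_subtype_mkQ Z) Z.mkQ_surjective
  obtain ⟨s, rfl⟩ := (e₁ t).1 h₁
  have hs : Z.mkQ.lTensor Z s = 0 := by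
    apply Module.Flat.rTensor_preserves_injective_linearMap (M := C ⧸ Z) _ Z.injective_subtype
    rw [map_zero, ← h₂, ← LinearMap.comp_apply, ← LinearMap.comp_apply,
      LinearMap.rTensor_comp_lTensor, LinearMap.lTensor_comp_rTensor]
  obtain ⟨r, rfl⟩ := (e₂ s).1 hs
  refine ⟨r, ?_⟩
  rw [← LinearMap.rTensor_comp_lTensor, LinearMap.comp_apply]

/-- A subcoalgebra is a right and left coideal. -/
theorem Subcoalgebra.mkQ_comul {k C : Type*} [Field k] [AddCommGroup C] [Module k C]
    [Coalgebra k C] (D : Subcoalgebra k C) (c : C) (hc : c ∈ D.toSubmodule) :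
    D.toSubmodule.mkQ.rTensor C (Coalgebra.comul (R := k) c) = 0 ∧
      D.toSubmodule.mkQ.lTensor C (Coalgebra.comul (R := k) c) = 0 := by
  obtain ⟨t, ht⟩ := D.comul_mem c hc
  have h : D.toSubmodule.mkQ ∘ₗ D.toSubmodule.subtype = 0 := by
    ext x
    simp
  rw [← ht, ← LinearMap.comp_apply, ← LinearMap.comp_apply, LinearMap.rTensor_comp_map,
    LinearMap.lTensor_comp_map, h]
  simp

theorem Subcoalgebra.comul_mem_wedge {k C : Type*} [Field k] [AddCommGroup C] [Module k C]
    [Coalgebra k C] (X Y : Subcoalgebra k C) (c : C)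
    (hc : c ∈ wedge X.toSubmodule Y.toSubmodule) :
    Coalgebra.comul (R := k) c ∈ LinearMap.range (TensorProduct.map
      (wedge X.toSubmodule Y.toSubmodule).subtype
      (wedge X.toSubmodule Y.toSubmodule).subtype) := by
  set p := X.toSubmodule.mkQ with hp
  set q := Y.toSubmodule.mkQ with hq
  set φ := TensorProduct.map p q ∘ₗ Coalgebra.comul (R := k) (A := C) with hφ
  have hZ : wedge X.toSubmodule Y.toSubmodule = LinearMap.ker φ := rfl
  rw [hZ] at hc ⊢
  have hc' : TensorProduct.map p q (Coalgebra.comul (R := k) c) = 0 := hc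
  obtain ⟨j, hj, hjφ⟩ : ∃ j : (C ⧸ LinearMap.ker φ) →ₗ[k] _, Function.Injective j ∧
      j ∘ₗ (LinearMap.ker φ).mkQ = φ :=
    ⟨(LinearMap.ker φ).liftQ φ le_rfl, LinearMap.ker_eq_bot.1 (Submodule.ker_liftQ_eq_bot _ _ _
      le_rfl), Submodule.liftQ_mkQ _ _ _⟩
  obtain ⟨g, hg⟩ : ∃ g : (C ⧸ Y.toSubmodule) →ₗ[k] _,
      g ∘ₗ q = q.rTensor C ∘ₗ Coalgebra.comul (R := k) :=
    ⟨Y.toSubmodule.liftQ (q.rTensor C ∘ₗ Coalgebra.comul (R := k)) (fun y hy => (Y.mkQ_comul y hy).1),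
      Submodule.liftQ_mkQ _ _ _⟩
  obtain ⟨g', hg'⟩ : ∃ g' : (C ⧸ X.toSubmodule) →ₗ[k] _,
      g' ∘ₗ p = p.lTensor C ∘ₗ Coalgebra.comul (R := k) :=
    ⟨X.toSubmodule.liftQ (p.lTensor C ∘ₗ Coalgebra.comul (R := k)) (fun x hx => (X.mkQ_comul x hx).2),
      Submodule.liftQ_mkQ _ _ _⟩
  apply mem_range_map_subtype
  · apply Module.Flat.rTensor_preserves_injective_linearMap (M := C) j hj
    rw [map_zero, ← LinearMap.comp_apply, ← LinearMap.rTensor_comp, hjφ, hφ,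
      LinearMap.rTensor_comp, LinearMap.comp_apply, ← Coalgebra.coassoc_symm_apply]
    have e : (TensorProduct.map p q).rTensor C ∘ₗ (TensorProduct.assoc k C C C).symm.toLinearMap
        = (TensorProduct.assoc k _ _ _).symm.toLinearMap ∘ₗ
          TensorProduct.map p (q.rTensor C) := by
      ext
      simp
    have h := LinearMap.congr_fun e ((Coalgebra.comul (R := k)).lTensor C
      (Coalgebra.comul (R := k) c))
    refine h.trans ?_
    rw [LinearMap.comp_apply, ← LinearMap.comp_apply _ (LinearMap.lTensor _ _),
      LinearMap.map_comp_lTensor, ← hg, ← LinearMap.lTensor_comp_map, LinearMap.comp_apply, hc',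
      map_zero, map_zero]
  · apply Module.Flat.lTensor_preserves_injective_linearMap (M := C) j hj
    rw [map_zero, ← LinearMap.comp_apply, ← LinearMap.lTensor_comp, hjφ, hφ,
      LinearMap.lTensor_comp, LinearMap.comp_apply, ← Coalgebra.coassoc_apply]
    have e : (TensorProduct.map p q).lTensor C ∘ₗ (TensorProduct.assoc k C C C).toLinearMap
        = (TensorProduct.assoc k _ _ _).toLinearMap ∘ₗ
          TensorProduct.map (p.lTensor C) q := by
      ext
      simp
    have h := LinearMap.congr_fun e ((Coalgebra.comul (R := k)).rTensor C
      (Coalgebra.comul (R := k) c))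
    refine h.trans ?_
    rw [LinearMap.comp_apply, ← LinearMap.comp_apply _ (LinearMap.rTensor _ _),
      LinearMap.map_comp_rTensor, ← hg', ← LinearMap.rTensor_comp_map, LinearMap.comp_apply, hc',
      map_zero, map_zero]

/-- The wedge powers of a subcoalgebra are subcoalgebras. -/
theorem Subcoalgebra.comul_mem_wedgePow {k C : Type*} [Field k] [AddCommGroup C] [Module k C]
    [Coalgebra k C] (A : Subcoalgebra k C) : ∀ (n : ℕ), ∀ c ∈ wedgePow A.toSubmodule n,
      Coalgebra.comul (R := k) c ∈ LinearMap.range (TensorProduct.map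
        (wedgePow A.toSubmodule n).subtype (wedgePow A.toSubmodule n).subtype)
  | 0, c, hc => by
    rw [(Submodule.mem_bot k).1 hc, map_zero]
    exact zero_mem _
  | 1, c, hc => A.comul_mem c hc
  | n + 2, c, hc => Subcoalgebra.comul_mem_wedge
      ⟨wedgePow A.toSubmodule (n + 1), A.comul_mem_wedgePow (n + 1)⟩ A c hc

theorem range_map_subtype_mono {k C : Type*} [Field k] [AddCommGroup C] [Module k C]
    {X Y : Submodule k C} (h : X ≤ Y) :
    LinearMap.range (TensorProduct.map X.subtype X.subtype) ≤
      LinearMap.range (TensorProduct.map Y.subtype Y.subtype) := by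
  rintro _ ⟨t, rfl⟩
  refine ⟨TensorProduct.map (Submodule.inclusion h) (Submodule.inclusion h) t, ?_⟩
  rw [← LinearMap.comp_apply, ← TensorProduct.map_comp]
  rfl

/-- For a subcoalgebra `A`, the subcoalgebra `A_∞` of `C`, the union of the ascending chain of
the wedge powers `⋀ⁿ A`, `n ≥ 1`. -/
def Subcoalgebra.infty {k C : Type*} [Field k] [AddCommGroup C] [Module k C]
    [Coalgebra k C] (A : Subcoalgebra k C) : Subcoalgebra k C where
  toSubmodule := ⨆ n, wedgePow A.toSubmodule n
  comul_mem := by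
    have h : (⨆ n, wedgePow A.toSubmodule n) ≤ Submodule.comap (Coalgebra.comul (R := k))
        (LinearMap.range (TensorProduct.map (⨆ n, wedgePow A.toSubmodule n).subtype
          (⨆ n, wedgePow A.toSubmodule n).subtype)) :=
      iSup_le fun n c hc => range_map_subtype_mono (le_iSup (wedgePow A.toSubmodule) n)
        (A.comul_mem_wedgePow n c hc)
    exact h

theorem Subcoalgebra.wedgePow_le_succ {k C : Type*} [Field k] [AddCommGroup C] [Module k C]
    [Coalgebra k C] (A : Subcoalgebra k C) :
    ∀ n, wedgePow A.toSubmodule n ≤ wedgePow A.toSubmodule (n + 1)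
  | 0 => bot_le
  | n + 1 => fun c hc => by
    have h := (Subcoalgebra.mkQ_comul
      ⟨wedgePow A.toSubmodule (n + 1), A.comul_mem_wedgePow (n + 1)⟩ c hc).1
    change TensorProduct.map _ _ _ = 0
    rw [← LinearMap.lTensor_comp_rTensor, LinearMap.comp_apply, h, map_zero]

/-- The underlying set of `A_∞` is `⋃_{n ≥ 1} ⋀ⁿ A`. -/
theorem Subcoalgebra.coe_infty {k C : Type*} [Field k] [AddCommGroup C] [Module k C]
    [Coalgebra k C] (A : Subcoalgebra k C) :
    (A.infty.toSubmodule : Set C) = ⋃ n ≥ 1, (wedgePow A.toSubmodule n : Set C) := by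
  have hmono : Monotone (wedgePow A.toSubmodule) := monotone_nat_of_le_succ A.wedgePow_le_succ
  ext c
  simp only [Set.mem_iUnion, SetLike.mem_coe]
  constructor
  · intro hc
    obtain ⟨n, hn⟩ := (Submodule.mem_iSup_of_directed _ hmono.directed_le).1 hc
    exact ⟨n + 1, Nat.le_add_left 1 n, A.wedgePow_le_succ n hn⟩
  · rintro ⟨n, -, hn⟩
    exact le_iSup (wedgePow A.toSubmodule) n hn

/-! A right comodule is a module over the dual algebra `Module.Dual k C`. Since slices separate
tensors over a field, subcomodules are the stable subspaces (`Subcomodule.ofAct`) and comodule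
morphisms are the linear maps commuting with the action (`mem_comodHom_iff`). Cyclic subcomodules
are finite-dimensional, and `toC` identifies functionals on `M` with morphisms `M → C`.

The main result is `IsRightStrictlyQuasiFinite.isStrictlyQuasiFinite`: over a right strictly
quasi-finite `C`, every quasi-finite comodule is strictly quasi-finite. Fix a simple `S`. Some
finite-dimensional `Q ⊆ C` meets every subcomodule of `C` having a nonzero morphism to `S`;
otherwise independent subcomodules `B n` with nonzero morphisms to `S` exist, and modulo the sum of
the kernels infinitely many independent copies of `S` appear. By induction on dimension, every
finite-dimensional comodule mapping nontrivially to `S` contains a simple comodule of one of the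
finitely many types in `Q`. In a quasi-finite `M` these types span a finite-dimensional subspace,
which is exhausted by finitely many morphisms to `C`. So `M` is built from subcomodules of `C` and a
comodule none of whose quotients contains `S`.

Statements (1) and (4) regard a simple comodule over a subcoalgebra, or over a direct sum, as a
simple comodule over the ambient coalgebra, or over one summand (`finite_comodHom_of_corestrict`).
For (3), an equivalence sends the regular comodule of `D` to a quasi-finite comodule over `C`, to
which the main result applies. For (2), every simple comodule with coefficients in `A_∞` already
embeds in `A`, so only finitely many types occur. Quasi-finiteness of the quotients of `C` then
stops descending chains; in the semiperfect case the coefficients of finitely many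
finite-dimensional projective covers span a space containing `A_∞`. -/

/-! ### The action of the dual algebra on a comodule -/

section Action

variable {k C D V W M N P : Type u} [Field k] [AddCommGroup C] [Module k C] [Coalgebra k C]
  [AddCommGroup V] [Module k V] [AddCommGroup W] [Module k W]
  [AddCommGroup M] [Module k M] [RightComodule k C M]
  [AddCommGroup N] [Module k N] [RightComodule k C N]
  [AddCommGroup P] [Module k P] [RightComodule k C P]

/-- Contraction of the right tensor factor with a functional. -/
noncomputable def rslice {E : Type u} [AddCommGroup E] [Module k E] (V : Type u) [AddCommGroup V]
    [Module k V] (f : Module.Dual k E) : V ⊗[k] E →ₗ[k] V :=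
  (TensorProduct.rid k V).toLinearMap ∘ₗ f.lTensor V

/-- Contraction of the left tensor factor with a functional. -/
noncomputable def lslice (E : Type u) [AddCommGroup E] [Module k E] {V : Type u} [AddCommGroup V]
    [Module k V] (f : Module.Dual k V) : V ⊗[k] E →ₗ[k] E :=
  (TensorProduct.lid k E).toLinearMap ∘ₗ f.rTensor E

section
variable {E : Type u} [AddCommGroup E] [Module k E]

@[simp] theorem rslice_tmul (f : Module.Dual k E) (v : V) (c : E) :
    rslice V f (v ⊗ₜ c) = f c • v := by simp [rslice]

@[simp] theorem lslice_tmul (f : Module.Dual k V) (v : V) (c : E) :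
    lslice E f (v ⊗ₜ c) = f v • c := by simp [lslice]

/-- In a basis of `E`, the coordinates of `t` are its slices by the coordinate functionals. -/
theorem eq_zero_of_rslice (t : V ⊗[k] E) (h : ∀ f : Module.Dual k E, rslice V f t = 0) :
    t = 0 := by
  classical
  let b := Module.Basis.ofVectorSpace k E
  apply (TensorProduct.equivFinsuppOfBasisRight (M := V) b).injective
  ext i
  rw [TensorProduct.equivFinsuppOfBasisRight_apply, map_zero]
  exact h _

theorem rslice_rTensor (g : V →ₗ[k] W) (f : Module.Dual k E) (t : V ⊗[k] E) :
    rslice W f (g.rTensor E t) = g (rslice V f t) := by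
  have : rslice W f ∘ₗ g.rTensor E = g ∘ₗ rslice V f := by ext; simp
  exact LinearMap.congr_fun this t

theorem rslice_lTensor {E' : Type u} [AddCommGroup E'] [Module k E'] (g : E →ₗ[k] E')
    (f : Module.Dual k E') (t : V ⊗[k] E) :
    rslice V f (g.lTensor V t) = rslice V (f ∘ₗ g) t := by
  have : rslice V f ∘ₗ g.lTensor V = rslice V (f ∘ₗ g) := by ext; simp
  exact LinearMap.congr_fun this t

theorem lslice_rTensor (g : V →ₗ[k] W) (f : Module.Dual k W) (t : V ⊗[k] E) :
    lslice E f (g.rTensor E t) = lslice E (f ∘ₗ g) t := by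
  have : lslice E f ∘ₗ g.rTensor E = lslice E (f ∘ₗ g) := by ext; simp
  exact LinearMap.congr_fun this t

theorem lslice_lTensor {E' : Type u} [AddCommGroup E'] [Module k E'] (g : E →ₗ[k] E')
    (f : Module.Dual k V) (t : V ⊗[k] E) :
    lslice E' f (g.lTensor V t) = g (lslice E f t) := by
  have : lslice E' f ∘ₗ g.lTensor V = g ∘ₗ lslice E f := by ext; simp
  exact LinearMap.congr_fun this t
end

/-- The action of a functional on `C` on a right `C`-comodule. -/
noncomputable def act (f : Module.Dual k C) : M →ₗ[k] M :=
  rslice M f ∘ₗ RightComodule.coact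

theorem act_apply (f : Module.Dual k C) (m : M) :
    act f m = rslice M f (RightComodule.coact m) := rfl

/-- The convolution product of functionals. -/
noncomputable def conv (f g : Module.Dual k C) : Module.Dual k C :=
  LinearMap.mul' k k ∘ₗ TensorProduct.map f g ∘ₗ Coalgebra.comul

/-- Coassociativity contracted with two functionals: comodules are left modules over the convolution
algebra. -/
theorem act_act (f g : Module.Dual k C) (m : M) : act f (act g m) = act (conv f g) m := by
  simp only [act_apply]
  rw [← rslice_rTensor]
  have h := LinearMap.congr_fun (RightComodule.coassoc (k := k) (C := C) (M := M)) m
  have e : rslice M f ∘ₗ rslice (M ⊗[k] C) g =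
      rslice M (LinearMap.mul' k k ∘ₗ TensorProduct.map f g) ∘ₗ
        (TensorProduct.assoc k M C C).toLinearMap := by
    ext; simp [smul_smul, mul_comm]
  refine (LinearMap.congr_fun e _).trans ?_
  have h' : (TensorProduct.assoc k M C C) (RightComodule.coact.rTensor C
      (RightComodule.coact (k := k) (C := C) m)) = (Coalgebra.comul (R := k)).lTensor M
        (RightComodule.coact (k := k) (C := C) m) := h
  simp only [LinearMap.comp_apply, LinearEquiv.coe_coe]
  rw [h', rslice_lTensor]
  rfl

theorem act_counit (m : M) : act (Coalgebra.counit (R := k) (A := C)) m = m := by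
  have h := LinearMap.congr_fun
    (RightComodule.lTensor_counit_comp_coact (k := k) (C := C) (M := M)) m
  simp only [LinearMap.comp_apply] at h
  simp [act_apply, rslice, h]

theorem mem_comodHom_iff {g : M →ₗ[k] N} :
    g ∈ comodHom k C M N ↔ ∀ (f : Module.Dual k C) (m : M), g (act f m) = act f (g m) := by
  constructor
  · intro (h : _ = _) f m
    have h' := LinearMap.congr_fun h m
    simp only [LinearMap.comp_apply] at h'
    rw [act_apply, act_apply, h', rslice_rTensor]
  · intro h
    refine LinearMap.ext fun m => sub_eq_zero.1 (eq_zero_of_rslice _ fun f => ?_)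
    rw [map_sub, LinearMap.comp_apply, LinearMap.comp_apply, rslice_rTensor, ← act_apply,
      ← act_apply, h, sub_self]

theorem comodHom.map_act {g : M →ₗ[k] N} (hg : g ∈ comodHom k C M N) (f : Module.Dual k C)
    (m : M) : g (act f m) = act f (g m) := mem_comodHom_iff.1 hg f m

theorem comodHom.comp {f : N →ₗ[k] P} {g : M →ₗ[k] N} (hf : f ∈ comodHom k C N P)
    (hg : g ∈ comodHom k C M N) : f ∘ₗ g ∈ comodHom k C M P :=
  mem_comodHom_iff.2 fun a m => by simp [comodHom.map_act hg, comodHom.map_act hf]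

theorem comodHom.id_mem : (LinearMap.id : M →ₗ[k] M) ∈ comodHom k C M M :=
  mem_comodHom_iff.2 fun _ _ => rfl

/-! ### Morphisms into the regular comodule -/

/-- The map from a comodule to `C` corresponding to a functional. -/
noncomputable def toC (φ : Module.Dual k M) : M →ₗ[k] C :=
  lslice C φ ∘ₗ RightComodule.coact

theorem toC_apply (φ : Module.Dual k M) (m : M) :
    toC (C := C) φ m = lslice C φ (RightComodule.coact m) := rfl

theorem toC_mem (φ : Module.Dual k M) : toC φ ∈ comodHom k C M C := by
  refine mem_comodHom_iff.2 fun f m => ?_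
  simp only [act_apply, toC_apply]
  rw [← rslice_rTensor]
  have h := LinearMap.congr_fun (RightComodule.coassoc (k := k) (C := C) (M := M)) m
  have h' : (TensorProduct.assoc k M C C) (RightComodule.coact.rTensor C
      (RightComodule.coact (k := k) (C := C) m)) = (Coalgebra.comul (R := k)).lTensor M
        (RightComodule.coact (k := k) (C := C) m) := h
  have e : lslice C φ ∘ₗ rslice (M ⊗[k] C) f =
      rslice C f ∘ₗ lslice (C ⊗[k] C) φ ∘ₗ (TensorProduct.assoc k M C C).toLinearMap := by
    ext; simp [smul_smul, mul_comm]
  refine (LinearMap.congr_fun e _).trans ?_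
  simp only [LinearMap.comp_apply, LinearEquiv.coe_coe]
  rw [h', lslice_lTensor]
  rfl

/-- Together with `toC_counit_comp` this makes `toC` and composition with the counit mutually
inverse. In particular `toC φ` does not kill an element on which `φ` is nonzero. -/
theorem counit_toC (φ : Module.Dual k M) (m : M) :
    Coalgebra.counit (R := k) (toC (C := C) φ m) = φ m := by
  have e : Coalgebra.counit (R := k) (A := C) ∘ₗ lslice C φ =
      φ ∘ₗ rslice M (Coalgebra.counit (R := k) (A := C)) := by
    ext; simp [mul_comm]
  refine (LinearMap.congr_fun e _).trans ?_
  rw [LinearMap.comp_apply, ← act_apply, act_counit]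

theorem toC_comp {q : M →ₗ[k] N} (hq : q ∈ comodHom k C M N) (φ : Module.Dual k N) (m : M) :
    toC (C := C) φ (q m) = toC (φ ∘ₗ q) m := by
  have h : RightComodule.coact (C := C) (q m) = q.rTensor C (RightComodule.coact (k := k) m) :=
    LinearMap.congr_fun hq m
  rw [toC_apply, toC_apply, h, lslice_rTensor]

theorem lslice_counit_comul (c : C) :
    lslice C (Coalgebra.counit (R := k) (A := C)) (Coalgebra.comul (R := k) c) = c := by
  have h := Coalgebra.rTensor_counit_comul (R := k) c
  simp [lslice, h]

theorem toC_counit_comp {h : M →ₗ[k] C} (hh : h ∈ comodHom k C M C) (m : M) :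
    toC (Coalgebra.counit (R := k) (A := C) ∘ₗ h) m = h m := by
  rw [← toC_comp hh]
  exact lslice_counit_comul _

/-! ### Subcomodules -/

theorem Subcomodule.act_mem (X : Subcomodule k C M) (f : Module.Dual k C) {m : M}
    (hm : m ∈ X.toSubmodule) : act f m ∈ X.toSubmodule := by
  obtain ⟨t, ht⟩ := X.coact_mem m hm
  rw [act_apply, ← ht, rslice_rTensor]
  exact Subtype.prop _

/-- A subspace stable under the action of the functionals is a subcomodule. -/
def Subcomodule.ofAct (X : Submodule k M) (h : ∀ (f : Module.Dual k C), ∀ m ∈ X, act f m ∈ X) :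
    Subcomodule k C M where
  toSubmodule := X
  coact_mem m hm := by
    have e := rTensor_exact C (LinearMap.exact_subtype_mkQ X) X.mkQ_surjective
    -- By exactness it is enough that the coaction vanishes in `(M ⧸ X) ⊗ C`, which is tested slice
    -- by slice.
    refine (e _).1 (eq_zero_of_rslice _ fun f => ?_)
    rw [rslice_rTensor, ← act_apply]
    simpa using h f m hm

/-- A subspace with a compatible coaction is a comodule. -/
@[reducible] def RightComodule.ofInjective (i : V →ₗ[k] M) (hi : Function.Injective i)
    (ρ : V →ₗ[k] V ⊗[k] C) (h : i.rTensor C ∘ₗ ρ = RightComodule.coact ∘ₗ i) : RightComodule k C V where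
  coact := ρ
  coassoc := by
    have hinj : Function.Injective (i.rTensor (C ⊗[k] C)) :=
      Module.Flat.rTensor_preserves_injective_linearMap _ hi
    apply (LinearMap.cancel_left hinj).1
    have e : i.rTensor (C ⊗[k] C) ∘ₗ (TensorProduct.assoc k V C C).toLinearMap =
        (TensorProduct.assoc k M C C).toLinearMap ∘ₗ (i.rTensor C).rTensor C := by
      ext; simp
    rw [← LinearMap.comp_assoc, e, LinearMap.comp_assoc, ← LinearMap.comp_assoc ρ,
      ← LinearMap.rTensor_comp, h, LinearMap.rTensor_comp, LinearMap.comp_assoc, h,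
      ← LinearMap.comp_assoc i, ← LinearMap.comp_assoc i, RightComodule.coassoc,
      ← LinearMap.comp_assoc ρ, LinearMap.rTensor_comp_lTensor, ← LinearMap.lTensor_comp_rTensor,
      LinearMap.comp_assoc, LinearMap.comp_assoc, h]
  lTensor_counit_comp_coact := by
    have hinj : Function.Injective (i.rTensor k) :=
      Module.Flat.rTensor_preserves_injective_linearMap _ hi
    apply (LinearMap.cancel_left hinj).1
    rw [← LinearMap.comp_assoc, LinearMap.rTensor_comp_lTensor, ← LinearMap.lTensor_comp_rTensor,
      LinearMap.comp_assoc, h, ← LinearMap.comp_assoc, RightComodule.lTensor_counit_comp_coact]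
    ext; simp

theorem Subcomodule.rTensor_subtype_injective (X : Subcomodule k C M) :
    Function.Injective (X.toSubmodule.subtype.rTensor C) :=
  Module.Flat.rTensor_preserves_injective_linearMap _ X.toSubmodule.injective_subtype

/-- The restricted coaction on a subcomodule. -/
noncomputable instance Subcomodule.instRightComodule (X : Subcomodule k C M) :
    RightComodule k C X.toSubmodule :=
  RightComodule.ofInjective X.toSubmodule.subtype X.toSubmodule.injective_subtype
    ((LinearEquiv.ofInjective _ X.rTensor_subtype_injective).symm.toLinearMap ∘ₗ
      (RightComodule.coact ∘ₗ X.toSubmodule.subtype).codRestrict _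
        (fun c => X.coact_mem c c.2))
    (by
      ext c
      exact congrArg Subtype.val
        ((LinearEquiv.ofInjective _ X.rTensor_subtype_injective).apply_symm_apply
          ((RightComodule.coact ∘ₗ X.toSubmodule.subtype).codRestrict _
            (fun c => X.coact_mem c c.2) c)))

theorem Subcomodule.subtype_mem (X : Subcomodule k C M) :
    X.toSubmodule.subtype ∈ comodHom k C X.toSubmodule M := by
  refine LinearMap.ext fun c => Eq.symm ?_
  exact congrArg Subtype.val
        ((LinearEquiv.ofInjective _ X.rTensor_subtype_injective).apply_symm_apply
          ((RightComodule.coact ∘ₗ X.toSubmodule.subtype).codRestrict _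
            (fun c => X.coact_mem c c.2) c))

theorem Subcomodule.coe_act (X : Subcomodule k C M) (f : Module.Dual k C) (x : X.toSubmodule) :
    ((act f x : X.toSubmodule) : M) = act f (x : M) :=
  comodHom.map_act X.subtype_mem f x

theorem Subcomodule.mkQ_mem (X : Subcomodule k C M) :
    X.toSubmodule.mkQ ∈ comodHom k C M (M ⧸ X.toSubmodule) :=
  Submodule.liftQ_mkQ _ _ _

theorem Subcomodule.act_mkQ (X : Subcomodule k C M) (f : Module.Dual k C) (m : M) :
    act f (X.toSubmodule.mkQ m) = X.toSubmodule.mkQ (act f m) :=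
  (comodHom.map_act X.mkQ_mem f m).symm

/-- The kernel of a morphism of comodules. -/
def Subcomodule.ker {g : M →ₗ[k] N} (hg : g ∈ comodHom k C M N) : Subcomodule k C M :=
  .ofAct (LinearMap.ker g) fun f m (hm : g m = 0) => by
    rw [LinearMap.mem_ker, comodHom.map_act hg, hm, map_zero]

/-- The image of a subcomodule. -/
def Subcomodule.map {g : M →ₗ[k] N} (hg : g ∈ comodHom k C M N) (X : Subcomodule k C M) :
    Subcomodule k C N :=
  .ofAct (X.toSubmodule.map g) fun f m => by
    rintro ⟨x, hx, rfl⟩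
    exact ⟨act f x, X.act_mem f hx, comodHom.map_act hg f x⟩

/-- The inverse image of a subcomodule. -/
def Subcomodule.comap {g : M →ₗ[k] N} (hg : g ∈ comodHom k C M N) (X : Subcomodule k C N) :
    Subcomodule k C M :=
  .ofAct (X.toSubmodule.comap g) fun f m hm => by
    rw [Submodule.mem_comap, comodHom.map_act hg]
    exact X.act_mem f hm

/-- The image of a morphism of comodules. -/
def Subcomodule.range {g : M →ₗ[k] N} (hg : g ∈ comodHom k C M N) : Subcomodule k C N :=
  .ofAct (LinearMap.range g) fun f m => by
    rintro ⟨x, rfl⟩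
    exact ⟨act f x, comodHom.map_act hg f x⟩

/-- The sum of a family of subcomodules. -/
def Subcomodule.iSup {ι : Sort*} (X : ι → Subcomodule k C M) : Subcomodule k C M :=
  .ofAct (⨆ i, (X i).toSubmodule) fun f => by
    change (⨆ i, (X i).toSubmodule) ≤ (⨆ i, (X i).toSubmodule).comap (act f)
    exact iSup_le fun i m hm => le_iSup (fun i => (X i).toSubmodule) i ((X i).act_mem f hm)

/-- The intersection of a family of subcomodules. -/
def Subcomodule.iInf {ι : Sort*} (X : ι → Subcomodule k C M) : Subcomodule k C M :=
  .ofAct (⨅ i, (X i).toSubmodule) fun f m hm => by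
    rw [Submodule.mem_iInf] at hm ⊢
    exact fun i => (X i).act_mem f (hm i)

/-- The sum of two subcomodules. -/
def Subcomodule.sup (X Y : Subcomodule k C M) : Subcomodule k C M :=
  .ofAct (X.toSubmodule ⊔ Y.toSubmodule) fun f => by
    change (X.toSubmodule ⊔ Y.toSubmodule) ≤ (X.toSubmodule ⊔ Y.toSubmodule).comap (act f)
    exact sup_le (fun m hm => Submodule.mem_sup_left (X.act_mem f hm))
      (fun m hm => Submodule.mem_sup_right (Y.act_mem f hm))

/-- The zero subcomodule. -/
def Subcomodule.zero : Subcomodule k C M :=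
  .ofAct ⊥ fun f m hm => by rw [(Submodule.mem_bot k).1 hm, map_zero]; exact zero_mem _

/-- The subcomodule generated by an element. -/
noncomputable def Subcomodule.cyclic (C : Type u) [AddCommGroup C] [Module k C] [Coalgebra k C]
    [RightComodule k C M] (m : M) : Subcomodule k C M :=
  .ofAct (LinearMap.range (
    { toFun := fun f => act f m
      map_add' := fun f g => by simp [act, rslice, LinearMap.lTensor_add]
      map_smul' := fun a f => by simp [act, rslice, LinearMap.lTensor_smul] } :
        Module.Dual k C →ₗ[k] M)) fun f _ => by
    rintro ⟨g, rfl⟩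
    exact ⟨conv f g, (act_act f g m).symm⟩

theorem Subcomodule.mem_cyclic (m : M) : m ∈ (Subcomodule.cyclic (k := k) C m).toSubmodule :=
  ⟨Coalgebra.counit, act_counit m⟩

theorem Subcomodule.cyclic_le (X : Subcomodule k C M) {m : M} (hm : m ∈ X.toSubmodule) :
    (Subcomodule.cyclic (k := k) C m).toSubmodule ≤ X.toSubmodule := by
  rintro _ ⟨f, rfl⟩
  exact X.act_mem f hm

/-- A tensor involves finitely many vectors of `V`, and their span contains all slices. This is the
source of local finiteness of comodules. -/
theorem exists_finite_rslice_mem {E : Type u} [AddCommGroup E] [Module k E] (t : V ⊗[k] E) :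
    ∃ F : Submodule k V, Module.Finite k F ∧ ∀ f : Module.Dual k E, rslice V f t ∈ F := by
  induction t with
  | zero => exact ⟨⊥, inferInstance, fun f => by simp⟩
  | tmul v c => exact ⟨k ∙ v, inferInstance, fun f => by
      rw [rslice_tmul]; exact Submodule.smul_mem _ _ (Submodule.mem_span_singleton_self v)⟩
  | add s t hs ht =>
    obtain ⟨F, _, hF⟩ := hs
    obtain ⟨G, _, hG⟩ := ht
    exact ⟨F ⊔ G, inferInstance, fun f => by
      rw [map_add]; exact Submodule.add_mem_sup (hF f) (hG f)⟩

instance Subcomodule.finite_cyclic (m : M) :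
    Module.Finite k (Subcomodule.cyclic (k := k) C m).toSubmodule := by
  obtain ⟨F, _, hF⟩ := exists_finite_rslice_mem (k := k) (RightComodule.coact (k := k) (C := C) m)
  refine Submodule.finiteDimensional_of_le (S₂ := F) ?_
  rintro _ ⟨f, rfl⟩
  exact hF f

/-! ### Factoring morphisms -/

theorem comodHom.exists_factor {f : M →ₗ[k] N} (hf : f ∈ comodHom k C M N)
    (hs : Function.Surjective f) {g : M →ₗ[k] P} (hg : g ∈ comodHom k C M P)
    (h : LinearMap.ker f ≤ LinearMap.ker g) : ∃ j ∈ comodHom k C N P, j ∘ₗ f = g := by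
  let e := f.quotKerEquivOfSurjective hs
  have hj : ((LinearMap.ker f).liftQ g h ∘ₗ e.symm.toLinearMap) ∘ₗ f = g := by
    ext m
    have : e.symm (f m) = Submodule.Quotient.mk m := by
      rw [LinearEquiv.symm_apply_eq]; rfl
    simp [this]
  refine ⟨_, mem_comodHom_iff.2 fun a n => ?_, hj⟩
  obtain ⟨m, rfl⟩ := hs n
  rw [← comodHom.map_act hf, ← LinearMap.comp_apply, hj, ← LinearMap.comp_apply _ f, hj,
    comodHom.map_act hg]

theorem comodHom.exists_lift {f : N →ₗ[k] P} (hf : f ∈ comodHom k C N P)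
    (hi : Function.Injective f) {g : M →ₗ[k] P} (hg : g ∈ comodHom k C M P)
    (h : LinearMap.range g ≤ LinearMap.range f) : ∃ j ∈ comodHom k C M N, f ∘ₗ j = g := by
  let e := LinearEquiv.ofInjective f hi
  have hj : f ∘ₗ (e.symm.toLinearMap ∘ₗ g.codRestrict _ (fun m => h ⟨m, rfl⟩)) = g := by
    ext m
    exact congrArg Subtype.val (e.apply_symm_apply (g.codRestrict _ (fun m => h ⟨m, rfl⟩) m))
  refine ⟨_, mem_comodHom_iff.2 fun a m => hi ?_, hj⟩
  rw [comodHom.map_act hf, ← LinearMap.comp_apply, hj, ← LinearMap.comp_apply f, hj,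
    comodHom.map_act hg]

/-! ### Simple comodules -/

theorem IsSimpleComodule.injective (hM : IsSimpleComodule k C M) {f : M →ₗ[k] N}
    (hf : f ∈ comodHom k C M N) (h0 : f ≠ 0) : Function.Injective f := by
  rcases hM.2 (Subcomodule.ker hf) with h | h
  · exact LinearMap.ker_eq_bot.1 h
  · exact absurd (LinearMap.ker_eq_top.1 h) h0

theorem IsSimpleComodule.surjective (hN : IsSimpleComodule k C N) {f : M →ₗ[k] N}
    (hf : f ∈ comodHom k C M N) (h0 : f ≠ 0) : Function.Surjective f := by
  rcases hN.2 (Subcomodule.range hf) with h | h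
  · exact absurd (LinearMap.range_eq_bot.1 h) h0
  · exact LinearMap.range_eq_top.1 h

theorem IsSimpleComodule.exists_inverse (hM : IsSimpleComodule k C M)
    (hN : IsSimpleComodule k C N) {f : M →ₗ[k] N} (hf : f ∈ comodHom k C M N) (h0 : f ≠ 0) :
    ∃ g ∈ comodHom k C N M, g ∘ₗ f = LinearMap.id ∧ f ∘ₗ g = LinearMap.id := by
  obtain ⟨g, hg, h⟩ := comodHom.exists_factor hf (hN.surjective hf h0) comodHom.id_mem
    (by rw [LinearMap.ker_eq_bot.2 (hM.injective hf h0)]; exact bot_le)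
  refine ⟨g, hg, h, ?_⟩
  rw [← LinearMap.cancel_right (hN.surjective hf h0), LinearMap.comp_assoc, h]
  rfl

theorem IsSimpleComodule.finite (hM : IsSimpleComodule k C M) : Module.Finite k M := by
  obtain ⟨m, hm⟩ := @exists_ne M hM.1 0
  rcases hM.2 (Subcomodule.cyclic (k := k) C m) with h | h
  · have := Subcomodule.mem_cyclic (k := k) (C := C) m
    rw [h] at this
    exact absurd ((Submodule.mem_bot k).1 this) hm
  · have : Module.Finite k (⊤ : Submodule k M) := h ▸ Subcomodule.finite_cyclic (C := C) m
    exact Module.Finite.of_surjective _ (Submodule.topEquiv (R := k) (M := M)).surjective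

/-- A nonzero subcomodule contains a simple one. -/
theorem Subcomodule.exists_simple_le (X : Subcomodule k C M) (hX : X.toSubmodule ≠ ⊥) :
    ∃ T : Subcomodule k C M, T.toSubmodule ≤ X.toSubmodule ∧
      IsSimpleComodule k C T.toSubmodule := by
  obtain ⟨m, hm, h0⟩ := Submodule.exists_mem_ne_zero_of_ne_bot hX
  let s : Set (Subcomodule k C M) :=
    {Y | Y.toSubmodule ≤ X.toSubmodule ∧ Y.toSubmodule ≠ ⊥ ∧ Module.Finite k Y.toSubmodule}
  have hs : s.Nonempty := ⟨Subcomodule.cyclic (k := k) C m, X.cyclic_le hm, fun h => h0 <| by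
    have := Subcomodule.mem_cyclic (k := k) (C := C) m
    rw [h] at this
    exact (Submodule.mem_bot k).1 this, inferInstance⟩
  let r : Subcomodule k C M → ℕ := fun Y => Module.finrank k Y.toSubmodule
  obtain ⟨T, ⟨h1, h2, h3⟩, hlt⟩ := (measure r).wf.has_min s hs
  refine ⟨T, h1, Submodule.nontrivial_iff_ne_bot.2 h2, fun Y => ?_⟩
  by_contra! hY
  have hle : (Y.map T.subtype_mem).toSubmodule ≤ T.toSubmodule := Submodule.map_subtype_le _ _
  refine hlt (Y.map T.subtype_mem) ⟨hle.trans h1, fun h => hY.1 ?_,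
    Submodule.finiteDimensional_of_le hle⟩ (Submodule.finrank_lt_finrank_of_lt
      (lt_of_le_of_ne hle fun h => hY.2 ?_))
  · exact Submodule.map_injective_of_injective T.toSubmodule.injective_subtype
      (h.trans (Submodule.map_bot _).symm)
  · apply Submodule.map_injective_of_injective T.toSubmodule.injective_subtype
    rw [Submodule.map_top, Submodule.range_subtype]
    exact h

/-- A nonzero finite-dimensional comodule has a simple quotient. -/
theorem exists_simple_quotient [Module.Finite k M] [Nontrivial M] :
    ∃ X : Subcomodule k C M, IsSimpleComodule k C (M ⧸ X.toSubmodule) := by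
  let s : Set (Subcomodule k C M) := {Y | Y.toSubmodule ≠ ⊤}
  have hs : s.Nonempty := ⟨Subcomodule.zero, bot_ne_top⟩
  let r : Subcomodule k C M → ℕ := fun Y => Module.finrank k (M ⧸ Y.toSubmodule)
  obtain ⟨T, h1, hlt⟩ := (measure r).wf.has_min s hs
  refine ⟨T, Submodule.Quotient.nontrivial_iff.2 h1, fun Y => ?_⟩
  by_contra! hY
  have hle : T.toSubmodule ≤ (Y.comap T.mkQ_mem).toSubmodule := fun x hx => by
    change T.toSubmodule.mkQ x ∈ Y.toSubmodule
    rw [Submodule.mkQ_apply, (Submodule.Quotient.mk_eq_zero _).2 hx]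
    exact zero_mem _
  refine hlt (Y.comap T.mkQ_mem) (fun h => hY.2 ?_) ?_
  · apply Submodule.comap_injective_of_surjective T.toSubmodule.mkQ_surjective
    rw [Submodule.comap_top]
    exact h
  · change Module.finrank k _ < Module.finrank k _
    have h2 : T.toSubmodule < (Y.comap T.mkQ_mem).toSubmodule := by
      refine lt_of_le_of_ne hle fun h => hY.1 ?_
      apply Submodule.comap_injective_of_surjective T.toSubmodule.mkQ_surjective
      rw [Submodule.comap_bot, Submodule.ker_mkQ]
      exact h.symm
    have := Submodule.finrank_lt_finrank_of_lt h2
    have e1 := Submodule.finrank_quotient_add_finrank T.toSubmodule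
    have e2 := Submodule.finrank_quotient_add_finrank (Y.comap T.mkQ_mem).toSubmodule
    omega

end Action

/-! ### Finiteness of spaces of morphisms -/

section Finiteness

variable {k C S M N P : Type u} [Field k] [AddCommGroup C] [Module k C] [Coalgebra k C]
  [AddCommGroup S] [Module k S] [RightComodule k C S]
  [AddCommGroup M] [Module k M] [RightComodule k C M]
  [AddCommGroup N] [Module k N] [RightComodule k C N]
  [AddCommGroup P] [Module k P] [RightComodule k C P]

/-- Composition with a fixed morphism. -/
def comodHom.postcomp (S : Type u) [AddCommGroup S] [Module k S] [RightComodule k C S]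
    {i : M →ₗ[k] N} (hi : i ∈ comodHom k C M N) : comodHom k C S M →ₗ[k] comodHom k C S N where
  toFun f := ⟨i ∘ₗ f.1, comodHom.comp hi f.2⟩
  map_add' f g := Subtype.ext (LinearMap.comp_add f.1 g.1 i)
  map_smul' a f := Subtype.ext (LinearMap.comp_smul i a f.1)

theorem finite_comodHom_of_injective {i : M →ₗ[k] N} (hi : i ∈ comodHom k C M N)
    (h : Function.Injective i) [Module.Finite k (comodHom k C S N)] :
    Module.Finite k (comodHom k C S M) := by
  refine Module.Finite.of_injective (comodHom.postcomp S hi) fun f g hfg => Subtype.ext ?_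
  exact (LinearMap.cancel_left h).1 (congrArg Subtype.val hfg)

/-- Left exactness of `Hom(S, -)`: a morphism killed by `p` factors through `i`. -/
theorem finite_comodHom_of_exact {i : M →ₗ[k] N} (hi : i ∈ comodHom k C M N)
    (h : Function.Injective i) {p : N →ₗ[k] P} (hp : p ∈ comodHom k C N P)
    (hip : LinearMap.ker p ≤ LinearMap.range i) [Module.Finite k (comodHom k C S M)]
    [Module.Finite k (comodHom k C S P)] : Module.Finite k (comodHom k C S N) := by
  refine ⟨Submodule.fg_of_fg_map_of_fg_inf_ker (comodHom.postcomp S hp)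
    (IsNoetherian.noetherian _) ?_⟩
  have hle : ⊤ ⊓ LinearMap.ker (comodHom.postcomp S hp) ≤
      LinearMap.range (comodHom.postcomp S hi) := by
    rintro f ⟨-, hf⟩
    have hf' : p ∘ₗ f.1 = 0 := congrArg Subtype.val hf
    obtain ⟨j, hj, hj'⟩ := comodHom.exists_lift hi h f.2
      (le_trans (by rintro _ ⟨s, rfl⟩; exact LinearMap.congr_fun hf' s) hip)
    exact ⟨⟨j, hj⟩, Subtype.ext hj'⟩
  exact (Submodule.fg_top _).1 (Submodule.finiteDimensional_of_le hle).1

/-- Morphisms from `S` to every quotient of `M` form a finite-dimensional space. -/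
def FiniteHomToQuotients (k C S M : Type u) [Field k] [AddCommGroup C] [Module k C] [Coalgebra k C]
    [AddCommGroup S] [Module k S] [RightComodule k C S]
    [AddCommGroup M] [Module k M] [RightComodule k C M] : Prop :=
  ∀ (N : Type u) [AddCommGroup N] [Module k N] [RightComodule k C N],
    ∀ π ∈ comodHom k C M N, Function.Surjective π → Module.Finite k (comodHom k C S N)

theorem finiteHomToQuotients_of_quotients
    (h : ∀ X : Subcomodule k C M, Module.Finite k (comodHom k C S (M ⧸ X.toSubmodule))) :
    FiniteHomToQuotients k C S M := by
  intro N _ _ _ π hπ hs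
  obtain ⟨j, hj, hj'⟩ := comodHom.exists_factor hπ hs (Subcomodule.ker hπ).mkQ_mem
    (le_of_eq (Submodule.ker_mkQ _).symm)
  have := h (Subcomodule.ker hπ)
  refine finite_comodHom_of_injective hj ((injective_iff_map_eq_zero j).2 fun n hn => ?_)
  obtain ⟨m, rfl⟩ := hs n
  rw [← LinearMap.comp_apply, hj'] at hn
  exact (Submodule.Quotient.mk_eq_zero _).1 hn

theorem isStrictlyQuasiFinite_iff : IsStrictlyQuasiFinite k C M ↔
    ∀ (S : Type u) [AddCommGroup S] [Module k S] [RightComodule k C S],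
      IsSimpleComodule k C S → FiniteHomToQuotients k C S M := by
  constructor
  · intro h S _ _ _ hS
    exact finiteHomToQuotients_of_quotients fun X => h X S hS
  · intro h X S _ _ _ hS
    exact h S hS _ _ X.mkQ_mem X.toSubmodule.mkQ_surjective

/-- The quotient of `M` by `ker π` embeds in the quotient of `N` by `i (ker π)`. -/
theorem FiniteHomToQuotients.of_injective (h : FiniteHomToQuotients k C S N) {i : M →ₗ[k] N}
    (hi : i ∈ comodHom k C M N) (hinj : Function.Injective i) :
    FiniteHomToQuotients k C S M := by
  intro M' _ _ _ π hπ hs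
  let X := (Subcomodule.ker hπ).map hi
  obtain ⟨j, hj, hj'⟩ := comodHom.exists_factor hπ hs (comodHom.comp X.mkQ_mem hi) (fun m hm =>
    (Submodule.Quotient.mk_eq_zero _).2 ⟨m, hm, rfl⟩)
  have := h _ _ X.mkQ_mem X.toSubmodule.mkQ_surjective
  refine finite_comodHom_of_injective hj ((injective_iff_map_eq_zero j).2 fun n hn => ?_)
  obtain ⟨m, rfl⟩ := hs n
  rw [← LinearMap.comp_apply, hj'] at hn
  obtain ⟨m', hm', h'⟩ := (Submodule.Quotient.mk_eq_zero _).1 hn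
  rw [← hinj h']
  exact hm'

/-- A quotient `M'` of `M` is an extension: `π (ker p)` is a quotient of `ker p`, and `M' / π (ker
p)` is a quotient of the image of `p`, a subcomodule of `P`. -/
theorem FiniteHomToQuotients.of_ker {p : M →ₗ[k] P} (hp : p ∈ comodHom k C M P)
    (h₁ : FiniteHomToQuotients k C S (Subcomodule.ker hp).toSubmodule)
    (h₂ : FiniteHomToQuotients k C S P) : FiniteHomToQuotients k C S M := by
  intro M' _ _ _ π hπ hs
  let R := Subcomodule.range hp
  have hR := h₂.of_injective R.subtype_mem R.toSubmodule.injective_subtype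
  let X := (Subcomodule.ker hp).map hπ
  obtain ⟨p', hp', hpp'⟩ := comodHom.exists_lift R.subtype_mem R.toSubmodule.injective_subtype hp
    (le_of_eq R.toSubmodule.range_subtype.symm)
  have hpp (m : M) : ((p' m : R.toSubmodule) : P) = p m := LinearMap.congr_fun hpp' m
  have hsurj : Function.Surjective p' := by
    rintro ⟨_, m, rfl⟩
    exact ⟨m, Subtype.ext (hpp m)⟩
  obtain ⟨j, hj, hj'⟩ := comodHom.exists_factor hp' hsurj (comodHom.comp X.mkQ_mem hπ)
    (fun m hm => (Submodule.Quotient.mk_eq_zero _).2 ⟨m, by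
      change p m = 0
      rw [← hpp, (LinearMap.mem_ker.1 hm : p' m = 0), Submodule.coe_zero], rfl⟩)
  have f₁ := hR _ j hj (by
    intro y
    obtain ⟨z, rfl⟩ := X.toSubmodule.mkQ_surjective y
    obtain ⟨m, rfl⟩ := hs z
    exact ⟨p' m, LinearMap.congr_fun hj' m⟩)
  obtain ⟨q, hq, hq'⟩ := comodHom.exists_lift X.subtype_mem X.toSubmodule.injective_subtype
    (comodHom.comp hπ (Subcomodule.ker hp).subtype_mem) (by
      rw [Submodule.range_subtype]
      rintro _ ⟨m, rfl⟩
      exact ⟨m, m.2, rfl⟩)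
  have f₂ := h₁ _ q hq (by
    rintro ⟨_, m, hm, rfl⟩
    exact ⟨⟨m, hm⟩, Subtype.ext (LinearMap.congr_fun hq' ⟨m, hm⟩)⟩)
  exact finite_comodHom_of_exact X.subtype_mem X.toSubmodule.injective_subtype X.mkQ_mem
    (by rw [Submodule.ker_mkQ, Submodule.range_subtype])

/-! ### Finitely many simple comodules in the socle of a finite-dimensional comodule -/

theorem Subcomodule.le_or_inf_eq_bot {T : Subcomodule k C M}
    (hT : IsSimpleComodule k C T.toSubmodule) (X : Subcomodule k C M) :
    T.toSubmodule ≤ X.toSubmodule ∨ T.toSubmodule ⊓ X.toSubmodule = ⊥ := by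
  rcases hT.2 (X.comap T.subtype_mem) with h | h
  · right
    rw [← Submodule.map_comap_subtype]
    exact (congrArg _ h).trans (Submodule.map_bot _)
  · left
    exact Submodule.comap_subtype_eq_top.1 h

/-- Remove a simple subcomodule `L`: a morphism from a simple comodule either lands in `L` or stays
nonzero in `Q / L`, which has smaller dimension. -/
theorem exists_simples_of_finite (n : ℕ) : ∀ (Q : Type u) [AddCommGroup Q] [Module k Q]
    [RightComodule k C Q] [Module.Finite k Q], Module.finrank k Q = n →
    ∃ l : List (ComodCat k C), (∀ L ∈ l, IsSimpleComodule k C L.carrier) ∧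
      ∀ (T : Type u) [AddCommGroup T] [Module k T] [RightComodule k C T],
        IsSimpleComodule k C T → ∀ h ∈ comodHom k C T Q, h ≠ 0 →
          ∃ L ∈ l, ∃ g ∈ comodHom k C T L.carrier, g ≠ 0 := by
  induction n using Nat.strong_induction_on with
  | _ n ih =>
    intro Q _ _ _ _ hn
    rcases subsingleton_or_nontrivial Q with hQ | hQ
    · exact ⟨[], by simp, fun T _ _ _ _ h _ h0 => absurd (Subsingleton.elim h 0) h0⟩
    obtain ⟨q, hq⟩ := exists_ne (0 : Q)
    obtain ⟨L, -, hL⟩ := (Subcomodule.cyclic (k := k) C q).exists_simple_le fun h => hq <| by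
      have := Subcomodule.mem_cyclic (k := k) (C := C) q
      rw [h] at this
      exact (Submodule.mem_bot k).1 this
    have hL0 : 0 < Module.finrank k L.toSubmodule := by
      have := hL.1
      exact Module.finrank_pos
    have e := Submodule.finrank_quotient_add_finrank L.toSubmodule
    obtain ⟨l, hl, hl'⟩ := ih _ (by omega) (Q ⧸ L.toSubmodule) rfl
    refine ⟨⟨L.toSubmodule⟩ :: l, ?_, ?_⟩
    · intro L' hL'
      rcases List.mem_cons.1 hL' with rfl | h
      · exact hL
      · exact hl _ h
    · intro T _ _ _ hT h hh h0
      by_cases hc : L.toSubmodule.mkQ ∘ₗ h = 0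
      · obtain ⟨j, hj, rfl⟩ := comodHom.exists_lift L.subtype_mem L.toSubmodule.injective_subtype hh
          (by
            rw [Submodule.range_subtype]
            rintro _ ⟨t, rfl⟩
            exact (Submodule.Quotient.mk_eq_zero _).1 (LinearMap.congr_fun hc t))
        refine ⟨_, List.mem_cons_self, j, hj, fun hj0 => h0 ?_⟩
        rw [hj0, LinearMap.comp_zero]
      · obtain ⟨L', hL', g, hg⟩ := hl' T hT _ (comodHom.comp L.mkQ_mem hh) hc
        exact ⟨L', List.mem_cons_of_mem _ hL', g, hg⟩

/-- Each `L` contributes the image of `Hom(L, M) ⊗ L → M`, and both tensor factors are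
finite-dimensional. -/
theorem exists_finite_range_le (hM : IsQuasiFinite k C M) (l : List (ComodCat k C))
    (hl : ∀ L ∈ l, IsSimpleComodule k C L.carrier) :
    ∃ F : Submodule k M, Module.Finite k F ∧
      ∀ L ∈ l, ∀ h ∈ comodHom k C L.carrier M, LinearMap.range h ≤ F := by
  induction l with
  | nil => exact ⟨⊥, inferInstance, by simp⟩
  | cons L l ih =>
    obtain ⟨F, _, hF⟩ := ih fun L' h => hl L' (List.mem_cons_of_mem _ h)
    have hL := hl L List.mem_cons_self
    have := hL.finite
    have := hM L.carrier hL
    let G := LinearMap.range (TensorProduct.lift (comodHom k C L.carrier M).subtype)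
    refine ⟨F ⊔ G, inferInstance, fun L' hL' h hh => ?_⟩
    rcases List.mem_cons.1 hL' with rfl | hmem
    · refine le_trans ?_ le_sup_right
      rintro _ ⟨x, rfl⟩
      exact ⟨⟨h, hh⟩ ⊗ₜ x, by simp⟩
    · exact (hF L' hmem h hh).trans le_sup_left

/-- In a quasi-finite comodule, the simple subcomodules which embed in a given finite-dimensional
comodule span a finite-dimensional subspace. -/
theorem IsQuasiFinite.exists_finite_range_le (hM : IsQuasiFinite k C M) (Q : Type u)
    [AddCommGroup Q] [Module k Q] [RightComodule k C Q] [Module.Finite k Q] :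
    ∃ F : Submodule k M, Module.Finite k F ∧
      ∀ (T : Type u) [AddCommGroup T] [Module k T] [RightComodule k C T],
        IsSimpleComodule k C T → ∀ g ∈ comodHom k C T Q, g ≠ 0 →
          ∀ h ∈ comodHom k C T M, LinearMap.range h ≤ F := by
  obtain ⟨l, hl, hl'⟩ := exists_simples_of_finite (k := k) (C := C) _ Q rfl
  obtain ⟨F, hF, hF'⟩ := _root_.exists_finite_range_le hM l hl
  refine ⟨F, hF, fun T _ _ _ hT g hg h0 h hh => ?_⟩
  obtain ⟨L, hL, j, hj, hj0⟩ := hl' T hT g hg h0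
  obtain ⟨i, hi, hij, -⟩ := hT.exists_inverse (hl L hL) hj hj0
  have := hF' L hL _ (comodHom.comp hh hi)
  rintro _ ⟨t, rfl⟩
  refine this ⟨j t, ?_⟩
  have ht : i (j t) = t := LinearMap.congr_fun hij t
  simp [ht]

/-! ### Quasi-finite comodules over a strictly quasi-finite coalgebra -/

theorem Subcomodule.inclusion_mem {X Y : Subcomodule k C M} (h : X.toSubmodule ≤ Y.toSubmodule) :
    Submodule.inclusion h ∈ comodHom k C X.toSubmodule Y.toSubmodule :=
  mem_comodHom_iff.2 fun f m => Subtype.ext <| by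
    rw [Submodule.coe_inclusion, X.coe_act, Y.coe_act, Submodule.coe_inclusion]

/-- The `B n` are successively independent, and modulo all the `ker (f n)` each becomes a copy of
`S`. The resulting copies remain independent in `P`, so `Hom(S, P)` has an ascending chain that
never becomes stationary. -/
theorem not_finite_comodHom_of_sequence (hS : IsSimpleComodule k C S)
    (Q N B : ℕ → Subcomodule k C M) (f : ∀ n, (B n).toSubmodule →ₗ[k] S)
    (hf : ∀ n, f n ∈ comodHom k C (B n).toSubmodule S) (hf0 : ∀ n, f n ≠ 0)
    (hNQ : ∀ n, (N n).toSubmodule ≤ (Q n).toSubmodule)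
    (hQ : ∀ n, (Q (n + 1)).toSubmodule = (Q n).toSubmodule ⊔ (B n).toSubmodule)
    (hN : ∀ n, (N (n + 1)).toSubmodule = (N n).toSubmodule ⊔
      (LinearMap.ker (f n)).map (B n).toSubmodule.subtype)
    (hd : ∀ n, (B n).toSubmodule ⊓ (Q n).toSubmodule = ⊥)
    {p : M →ₗ[k] P} (hp : p ∈ comodHom k C M P)
    (hker : LinearMap.ker p = (Subcomodule.iSup N).toSubmodule) :
    ¬ Module.Finite k (comodHom k C S P) := by
  intro hfin
  let K := Subcomodule.iSup N
  have hNmono : Monotone fun n => (N n).toSubmodule :=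
    monotone_nat_of_le_succ fun n => by rw [hN]; exact le_sup_left
  have hQmono : Monotone fun n => (Q n).toSubmodule :=
    monotone_nat_of_le_succ fun n => by rw [hQ]; exact le_sup_left
  -- Kernels added after stage `n` contribute nothing inside `Q n`, because the later `B` are
  -- independent of it.
  have hstep : ∀ n d, (N (n + d)).toSubmodule ⊓ (Q n).toSubmodule ≤ (N n).toSubmodule := by
    intro n d
    induction d with
    | zero => exact inf_le_left
    | succ d ih =>
      rintro x ⟨hx, hxQ⟩
      rw [← add_assoc, hN] at hx
      obtain ⟨y, hy, a, ha, rfl⟩ := Submodule.mem_sup.1 hx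
      obtain ⟨a, ha, rfl⟩ := ha
      have h1 : (a : M) ∈ (Q (n + d)).toSubmodule := by
        have := Submodule.sub_mem _ (hQmono (Nat.le_add_right n d) hxQ) (hNQ _ hy)
        simpa using this
      have h2 : (a : M) = 0 := by
        have : (a : M) ∈ (B (n + d)).toSubmodule ⊓ (Q (n + d)).toSubmodule := ⟨a.2, h1⟩
        rw [hd] at this
        exact (Submodule.mem_bot k).1 this
      have h3 : y + (B (n + d)).toSubmodule.subtype a = y := by simp [h2]
      rw [h3] at hxQ ⊢
      exact ih ⟨hy, hxQ⟩
  have hKQ : ∀ n, K.toSubmodule ⊓ (Q n).toSubmodule ≤ (N n).toSubmodule := by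
    rintro n x ⟨hx, hxQ⟩
    obtain ⟨m, hm⟩ := (Submodule.mem_iSup_of_directed _ hNmono.directed_le).1 hx
    exact hstep n m ⟨hNmono (Nat.le_add_left m n) hm, hxQ⟩
  -- Morphisms filtered by the stage whose image in `P` contains their range; finite dimension would
  -- make this chain stationary.
  let H : ℕ → Submodule k (comodHom k C S P) := fun n =>
    { carrier := {h | ∀ s, h.1 s ∈ (Q n).toSubmodule.map p}
      add_mem' := fun ha hb s => Submodule.add_mem _ (ha s) (hb s)
      zero_mem' := fun s => zero_mem _
      smul_mem' := fun c h hh s => Submodule.smul_mem _ c (hh s) }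
  have hH : Monotone H := fun a b hab h hh s => Submodule.map_mono (hQmono hab) (hh s)
  obtain ⟨n, hn⟩ := WellFoundedGT.monotone_chain_condition (α := Submodule k _) ⟨H, hH⟩
  have heq : H n = H (n + 1) := hn (n + 1) (Nat.le_succ n)
  have hs := hS.surjective (hf n) (hf0 n)
  have hkerK : (LinearMap.ker (f n)).map (B n).toSubmodule.subtype ≤ K.toSubmodule :=
    le_trans (by rw [hN]; exact le_sup_right) (le_iSup (fun n => (N n).toSubmodule) (n + 1))
  obtain ⟨h, hh, hhf⟩ := comodHom.exists_factor (hf n) hs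
    (comodHom.comp hp (B n).subtype_mem) (fun b hb => by
      have : (b : M) ∈ LinearMap.ker p := by rw [hker]; exact hkerK ⟨b, hb, rfl⟩
      exact this)
  have hmem : (⟨h, hh⟩ : comodHom k C S _) ∈ H (n + 1) := fun s => by
    obtain ⟨b, rfl⟩ := hs s
    refine ⟨b, ?_, (LinearMap.congr_fun hhf b).symm⟩
    rw [SetLike.mem_coe, hQ]
    exact Submodule.mem_sup_right b.2
  rw [← heq] at hmem
  refine hf0 n (LinearMap.ext fun b => ?_)
  obtain ⟨q, hq, hqb⟩ := hmem (f n b)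
  have hqb' : p q = p (b : M) :=
    hqb.trans (LinearMap.congr_fun hhf b)
  have hdK : (b : M) - q ∈ K.toSubmodule := by
    change _ ∈ (Subcomodule.iSup N).toSubmodule
    rw [← hker, LinearMap.mem_ker, map_sub, hqb', sub_self]
  have hdN := hKQ (n + 1) ⟨hdK, by
    rw [SetLike.mem_coe, hQ]
    exact Submodule.sub_mem _ (Submodule.mem_sup_right b.2) (Submodule.mem_sup_left hq)⟩
  rw [hN] at hdN
  obtain ⟨y, hy, a, ⟨a, ha, rfl⟩, hya⟩ := Submodule.mem_sup.1 hdN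
  -- The difference lies in both `B n` and `Q n`, hence vanishes; so `b` equals an element of `ker
  -- (f n)`.
  have h1 : ((b - a : (B n).toSubmodule) : M) = q + y := by
    rw [Submodule.coe_sub]
    have h2 : y + (a : M) = (b : M) - q := hya
    rw [sub_eq_iff_eq_add, add_assoc, h2]
    abel
  have h2 : ((b - a : (B n).toSubmodule) : M) = 0 := by
    have : ((b - a : (B n).toSubmodule) : M) ∈ (B n).toSubmodule ⊓ (Q n).toSubmodule :=
      ⟨Subtype.prop _, by rw [h1]; exact Submodule.add_mem _ hq (hNQ n hy)⟩
    rw [hd] at this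
    exact (Submodule.mem_bot k).1 this
  have h3 : b = a := sub_eq_zero.1 (Subtype.ext h2)
  rw [h3]
  exact ha

/-- If no such `Q` existed, a subcomodule avoiding the current `Q` and mapping nontrivially to `S`
could be adjoined at every stage, giving the sequence excluded by `not_finite_comodHom_of_sequence`.
-/
theorem FiniteHomToQuotients.exists_finite (h : FiniteHomToQuotients k C S M)
    (hS : IsSimpleComodule k C S) : ∃ Q : Subcomodule k C M, Module.Finite k Q.toSubmodule ∧
      ∀ X : Subcomodule k C M, X.toSubmodule ⊓ Q.toSubmodule = ⊥ →
        ∀ f ∈ comodHom k C X.toSubmodule S, f = 0 := by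
  by_contra! H
  have H' : ∀ Q : {Q : Subcomodule k C M // Module.Finite k Q.toSubmodule},
      ∃ (B : Subcomodule k C M) (f : B.toSubmodule →ₗ[k] S), Module.Finite k B.toSubmodule ∧
        B.toSubmodule ⊓ Q.1.toSubmodule = ⊥ ∧ f ∈ comodHom k C B.toSubmodule S ∧ f ≠ 0 := by
    rintro ⟨Q, hQ⟩
    obtain ⟨X, hX, f, hf, hf0⟩ := H Q hQ
    obtain ⟨x, hx⟩ : ∃ x, f x ≠ 0 := by
      by_contra! hc
      exact hf0 (LinearMap.ext hc)
    -- Passing to a cyclic subcomodule makes `B` finite-dimensional, so that `Q + B` can serve as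
    -- the next `Q`.
    have hle := X.cyclic_le (C := C) x.2
    refine ⟨Subcomodule.cyclic (k := k) C (x : M), f ∘ₗ Submodule.inclusion hle, inferInstance,
      le_bot_iff.1 (hX ▸ inf_le_inf_right _ hle), comodHom.comp hf (Subcomodule.inclusion_mem hle),
      fun h0 => hx ?_⟩
    exact LinearMap.congr_fun h0 ⟨x, Subcomodule.mem_cyclic _⟩
  choose B f hB hd hf hf0 using H'
  let Q : ℕ → {Q : Subcomodule k C M // Module.Finite k Q.toSubmodule} := fun n =>
    Nat.rec ⟨Subcomodule.zero, inferInstanceAs (Module.Finite k (⊥ : Submodule k M))⟩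
      (fun _ Q => ⟨Q.1.sup (B Q), by
        have := Q.2
        have := hB Q
        exact inferInstanceAs (Module.Finite k (Q.1.toSubmodule ⊔ (B Q).toSubmodule :
          Submodule k M))⟩) n
  let N : ℕ → Subcomodule k C M := fun n =>
    Nat.rec Subcomodule.zero
      (fun n N => N.sup ((Subcomodule.ker (hf (Q n))).map (B (Q n)).subtype_mem)) n
  have hNQ : ∀ n, (N n).toSubmodule ≤ (Q n).1.toSubmodule := by
    intro n
    induction n with
    | zero => exact le_rfl
    | succ n ih => exact sup_le_sup ih (Submodule.map_subtype_le _ _)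
  exact not_finite_comodHom_of_sequence hS (fun n => (Q n).1) N (fun n => B (Q n))
    (fun n => f (Q n)) (fun n => hf _) (fun n => hf0 _) hNQ (fun n => rfl) (fun n => rfl)
    (fun n => hd _) (Subcomodule.mkQ_mem _) (Submodule.ker_mkQ _)
    (h _ _ (Subcomodule.mkQ_mem _) (Submodule.mkQ_surjective _))

/-- The property of `Q` inside `C` is carried over to an arbitrary finite-dimensional `B`. Modulo a
largest subcomodule `U` missing a simple `T`, `B` embeds in `C`. By induction `f` kills `U`, so `f`
is visible on the image of `B` in `C`. -/
theorem comodHom_eq_zero_of_disjoint (Q : Subcomodule k C C)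
    (hQ : ∀ X : Subcomodule k C C, X.toSubmodule ⊓ Q.toSubmodule = ⊥ →
        ∀ f ∈ comodHom k C X.toSubmodule S, f = 0) (n : ℕ) :
    ∀ (B : Type u) [AddCommGroup B] [Module k B] [RightComodule k C B] [Module.Finite k B],
      Module.finrank k B = n →
      (∀ (T : Type u) [AddCommGroup T] [Module k T] [RightComodule k C T],
        IsSimpleComodule k C T → ∀ g ∈ comodHom k C T Q.toSubmodule, g ≠ 0 →
          ∀ h ∈ comodHom k C T B, h = 0) →
      ∀ f ∈ comodHom k C B S, f = 0 := by
  induction n using Nat.strong_induction_on with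
  | _ n ih =>
    intro B _ _ _ _ hn hB f hf
    by_contra hf0
    obtain ⟨b, hb⟩ : ∃ b, f b ≠ 0 := by
      by_contra! hc
      exact hf0 (LinearMap.ext hc)
    obtain ⟨T, -, hT⟩ := (Subcomodule.cyclic (k := k) C b).exists_simple_le fun h => hb <| by
      have := Subcomodule.mem_cyclic (k := k) (C := C) b
      rw [h] at this
      rw [(Submodule.mem_bot k).1 this, map_zero]
    have := hT.1
    obtain ⟨t, ht0⟩ := exists_ne (0 : T.toSubmodule)
    have ht0' : (t : B) ≠ 0 := fun h => ht0 (Subtype.ext h)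
    let s : Set (Subcomodule k C B) := {U | T.toSubmodule ⊓ U.toSubmodule = ⊥}
    obtain ⟨U, hU, hmax⟩ := (measure fun U : Subcomodule k C B =>
      Module.finrank k (B ⧸ U.toSubmodule)).wf.has_min s ⟨Subcomodule.zero, inf_bot_eq _⟩
    have hmax' : ∀ Y : Subcomodule k C B, U.toSubmodule ≤ Y.toSubmodule →
        T.toSubmodule ⊓ Y.toSubmodule = ⊥ → U.toSubmodule = Y.toSubmodule := by
      intro Y hUY hY
      by_contra hne
      refine hmax Y hY ?_
      change Module.finrank k _ < Module.finrank k _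
      have := Submodule.finrank_lt_finrank_of_lt (lt_of_le_of_ne hUY hne)
      have e1 := Submodule.finrank_quotient_add_finrank U.toSubmodule
      have e2 := Submodule.finrank_quotient_add_finrank Y.toSubmodule
      omega
    have htU : (t : B) ∉ U.toSubmodule := fun h => ht0' <| by
      have : (t : B) ∈ T.toSubmodule ⊓ U.toSubmodule := ⟨t.2, h⟩
      rw [hU] at this
      exact (Submodule.mem_bot k).1 this
    have hUf : U.toSubmodule ≤ LinearMap.ker f := by
      have hlt : Module.finrank k U.toSubmodule < n := by
        rw [← hn]
        exact Submodule.finrank_lt fun h => htU (h ▸ Submodule.mem_top)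
      have h0 := ih _ hlt U.toSubmodule rfl (fun T' _ _ _ hT' g hg hg0 h hh => by
        have := hB T' hT' g hg hg0 _ (comodHom.comp U.subtype_mem hh)
        exact (LinearMap.cancel_left U.toSubmodule.injective_subtype).1
          (this.trans (LinearMap.comp_zero _).symm)) _ (comodHom.comp hf U.subtype_mem)
      exact fun u hu => LinearMap.congr_fun h0 ⟨u, hu⟩
    -- A functional vanishing on `U` but not at `t` yields a morphism `g` to `C` that kills `U` and
    -- not `T`; maximality of `U` forces `ker g = U`.
    obtain ⟨φ, hφt, hφU⟩ := Submodule.exists_dual_map_eq_bot_of_notMem htU inferInstance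
    have hφU' : φ ∘ₗ U.toSubmodule.subtype = 0 := by
      ext u
      have : φ u ∈ U.toSubmodule.map φ := ⟨u, u.2, rfl⟩
      rw [hφU] at this
      exact (Submodule.mem_bot k).1 this
    have hg := toC_mem (C := C) φ
    set g := toC (C := C) φ with hgdef
    have hgt : g t ≠ 0 := fun h => hφt <| by
      rw [← counit_toC (C := C) φ, ← hgdef, h, map_zero]
    have hUg : U.toSubmodule ≤ LinearMap.ker g := fun u hu => by
      have h := toC_comp (C := C) U.subtype_mem φ ⟨u, hu⟩
      rw [hφU', toC_apply _ (⟨u, hu⟩ : U.toSubmodule)] at h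
      exact h.trans (by simp [lslice])
    have hUker : U.toSubmodule = LinearMap.ker g := hmax' (Subcomodule.ker hg) hUg <| by
      rcases Subcomodule.le_or_inf_eq_bot hT (Subcomodule.ker hg) with h | h
      · exact absurd (h t.2) hgt
      · exact h
    -- If `T` missed the preimage of `Q`, maximality would make that preimage equal to `U`. Then the
    -- image of `g` would miss `Q`, and `f`, which factors through it, would vanish.
    have hTY : T.toSubmodule ≤ (Q.comap hg).toSubmodule := by
      rcases Subcomodule.le_or_inf_eq_bot hT (Q.comap hg) with h | h
      · exact h
      exfalso
      have hUY := hmax' (Q.comap hg) (fun u hu => by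
        change g u ∈ Q.toSubmodule
        rw [(LinearMap.mem_ker.1 (hUg hu) : g u = 0)]
        exact zero_mem _) h
      let X := Subcomodule.range hg
      have hXQ : X.toSubmodule ⊓ Q.toSubmodule = ⊥ := by
        rw [eq_bot_iff]
        rintro _ ⟨⟨y, rfl⟩, hy⟩
        have : y ∈ U.toSubmodule := by rw [hUY]; exact hy
        exact hUg this
      obtain ⟨g', hg', hgg'⟩ := comodHom.exists_lift X.subtype_mem
        X.toSubmodule.injective_subtype hg (le_of_eq X.toSubmodule.range_subtype.symm)
      have hgg (m : B) : ((g' m : X.toSubmodule) : C) = g m := LinearMap.congr_fun hgg' m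
      obtain ⟨j, hj, hjf⟩ := comodHom.exists_factor hg' (by
        rintro ⟨_, m, rfl⟩
        exact ⟨m, Subtype.ext (hgg m)⟩) hf (fun m hm => hUf <| by
          rw [hUker, LinearMap.mem_ker, ← hgg, (LinearMap.mem_ker.1 hm : g' m = 0),
            Submodule.coe_zero])
      rw [hQ X hXQ j hj, LinearMap.zero_comp] at hjf
      exact hf0 hjf.symm
    obtain ⟨j, hj, hj'⟩ := comodHom.exists_lift Q.subtype_mem Q.toSubmodule.injective_subtype
      (comodHom.comp hg T.subtype_mem) (by
        rw [Submodule.range_subtype]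
        rintro _ ⟨x, rfl⟩
        exact hTY x.2)
    have hj0 : j ≠ 0 := by
      rintro rfl
      exact hgt (LinearMap.congr_fun hj' t).symm
    exact ht0' (LinearMap.congr_fun (hB _ hT j hj hj0 _ T.subtype_mem) t)

/-- `F` contains all simple subcomodules of the types in `Q`. Each morphism to `C` that is nonzero
on `F` cuts `F` down, while its image is controlled by `hC`. When nothing of `F` is left, no
quotient of `M` contains a copy of `S`. -/
theorem FiniteHomToQuotients.of_finite_socle (hC : FiniteHomToQuotients k C S C)
    (hS : IsSimpleComodule k C S)
    (Q : Subcomodule k C C)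
    (hQ : ∀ X : Subcomodule k C C, X.toSubmodule ⊓ Q.toSubmodule = ⊥ →
        ∀ f ∈ comodHom k C X.toSubmodule S, f = 0) (n : ℕ) :
    ∀ (M : Type u) [AddCommGroup M] [Module k M] [RightComodule k C M] (F : Submodule k M)
      [Module.Finite k F], Module.finrank k F = n →
      (∀ (T : Type u) [AddCommGroup T] [Module k T] [RightComodule k C T],
        IsSimpleComodule k C T → ∀ g ∈ comodHom k C T Q.toSubmodule, g ≠ 0 →
          ∀ h ∈ comodHom k C T M, LinearMap.range h ≤ F) →
      FiniteHomToQuotients k C S M := by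
  induction n using Nat.strong_induction_on with
  | _ n ih =>
    intro M _ _ _ F _ hn hF
    by_cases hF0 : F = ⊥
    · intro M' _ _ _ π hπ hs
      suffices h : ∀ h ∈ comodHom k C S M', h = 0 by
        have : Subsingleton (comodHom k C S M') :=
          ⟨fun a b => Subtype.ext ((h _ a.2).trans (h _ b.2).symm)⟩
        infer_instance
      intro h hh
      by_contra h0
      obtain ⟨s, hs0⟩ : ∃ s, h s ≠ 0 := by
        by_contra! hc
        exact h0 (LinearMap.ext hc)
      obtain ⟨m, hm⟩ := hs (h s)
      -- The finite-dimensional `B` generated by a lift of `h s` is mapped by `π` into the copy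
      -- `h(S)` of `S`, giving a nonzero morphism `B → S`.
      let B := Subcomodule.cyclic (k := k) C m
      have hinj := hS.injective hh h0
      obtain ⟨f, hf, hf'⟩ := comodHom.exists_lift hh hinj (comodHom.comp hπ B.subtype_mem) (by
        rintro _ ⟨⟨_, a, rfl⟩, rfl⟩
        refine ⟨act a s, ?_⟩
        rw [comodHom.map_act hh, ← hm, ← comodHom.map_act hπ]
        rfl)
      have hf0 := comodHom_eq_zero_of_disjoint Q hQ _ B.toSubmodule rfl
        (fun T _ _ _ hT g hg hg0 j hj => by
          have := hF T hT g hg hg0 _ (comodHom.comp B.subtype_mem hj)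
          rw [hF0, le_bot_iff, LinearMap.range_eq_bot] at this
          exact (LinearMap.cancel_left B.toSubmodule.injective_subtype).1
            (this.trans (LinearMap.comp_zero _).symm)) f hf
      rw [hf0, LinearMap.comp_zero] at hf'
      exact hs0 (hm ▸ (LinearMap.congr_fun hf' ⟨m, Subcomodule.mem_cyclic m⟩).symm)
    · obtain ⟨x, hx, hx0⟩ := Submodule.exists_mem_ne_zero_of_ne_bot hF0
      obtain ⟨φ, hφ⟩ : ∃ φ : Module.Dual k M, φ x ≠ 0 := by
        by_contra! hc
        exact hx0 ((Module.forall_dual_apply_eq_zero_iff k x).1 hc)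
      have hg := toC_mem (C := C) φ
      let K := Subcomodule.ker hg
      refine FiniteHomToQuotients.of_ker hg ?_ hC
      let G := F.comap K.toSubmodule.subtype
      have hmap : G.map K.toSubmodule.subtype = K.toSubmodule ⊓ F := Submodule.map_comap_subtype _ _
      have : Module.Finite k (G.map K.toSubmodule.subtype) := by
        rw [hmap]
        exact Submodule.finiteDimensional_of_le inf_le_right
      have e := Submodule.equivMapOfInjective K.toSubmodule.subtype
        K.toSubmodule.injective_subtype G
      have : Module.Finite k G := Module.Finite.equiv e.symm
      refine ih (Module.finrank k G) ?_ K.toSubmodule G rfl (fun T _ _ _ hT g hg hg0 h hh => ?_)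
      · rw [e.finrank_eq, hmap, ← hn]
        refine Submodule.finrank_lt_finrank_of_lt (lt_of_le_of_ne inf_le_right fun h => hφ ?_)
        rw [← h] at hx
        rw [← counit_toC (C := C) φ, (LinearMap.mem_ker.1 hx.1 : toC (C := C) φ x = 0), map_zero]
      · rintro _ ⟨y, rfl⟩
        exact hF T hT g hg hg0 _ (comodHom.comp K.subtype_mem hh) ⟨y, rfl⟩

/-- Over a right strictly quasi-finite coalgebra, quasi-finite comodules are strictly
quasi-finite. -/
theorem IsRightStrictlyQuasiFinite.isStrictlyQuasiFinite (hC : IsRightStrictlyQuasiFinite k C)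
    (hM : IsQuasiFinite k C M) : IsStrictlyQuasiFinite k C M := by
  refine isStrictlyQuasiFinite_iff.2 fun S _ _ _ hS => ?_
  have hCS := isStrictlyQuasiFinite_iff.1 hC S hS
  -- `Q` depends on `S` and `C` only; quasi-finiteness of `M` is needed just for the finitely many
  -- simple types in `Q`.
  obtain ⟨Q, _, hQ⟩ := hCS.exists_finite hS
  obtain ⟨F, _, hF⟩ := hM.exists_finite_range_le Q.toSubmodule
  exact hCS.of_finite_socle hS Q hQ _ M F rfl hF

end Finiteness

/-! ### Corestriction of comodules -/

section Corestriction

variable {k C D S : Type u} [Field k] [AddCommGroup C] [Module k C] [Coalgebra k C]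
  [AddCommGroup D] [Module k D] [Coalgebra k D]
  [AddCommGroup S] [Module k S] [RightComodule k D S]

/-- The corestriction of a comodule along a comultiplicative map which preserves the counit as far
as this comodule is concerned. -/
@[reducible] noncomputable def RightComodule.corestrict (ψ : D →ₗ[k] C)
    (hψ : TensorProduct.map ψ ψ ∘ₗ Coalgebra.comul = Coalgebra.comul ∘ₗ ψ)
    (hS : ∀ s : S, act (Coalgebra.counit (R := k) ∘ₗ ψ) s = s) : RightComodule k C S where
  coact := ψ.lTensor S ∘ₗ coact
  coassoc := by
    have e : (TensorProduct.assoc k S C C).toLinearMap ∘ₗ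
        TensorProduct.map (ψ.lTensor S) ψ = (TensorProduct.map ψ ψ).lTensor S ∘ₗ
          (TensorProduct.assoc k S D D).toLinearMap := by
      ext; simp
    rw [LinearMap.rTensor_comp, LinearMap.comp_assoc, ← LinearMap.comp_assoc coact,
      LinearMap.rTensor_comp_lTensor, ← LinearMap.lTensor_comp_rTensor,
      ← LinearMap.comp_assoc _ _ (LinearMap.rTensor C _), ← LinearMap.comp_assoc _ _
        (LinearMap.rTensor C _), LinearMap.rTensor_comp_lTensor, LinearMap.comp_assoc,
      ← LinearMap.comp_assoc _ _ (TensorProduct.assoc k S C C).toLinearMap, e,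
      LinearMap.comp_assoc, coassoc, ← LinearMap.comp_assoc, ← LinearMap.comp_assoc,
      ← LinearMap.lTensor_comp, ← LinearMap.lTensor_comp, hψ]
  lTensor_counit_comp_coact := by
    ext s
    have h := hS s
    rw [act_apply, ← rslice_lTensor] at h
    apply (TensorProduct.rid k S).injective
    have e (t : S ⊗[k] C) : TensorProduct.rid k S ((Coalgebra.counit (R := k)).lTensor S t) =
      rslice S Coalgebra.counit t := rfl
    simpa [e] using h

theorem act_corestrict (ψ : D →ₗ[k] C)
    (hψ : TensorProduct.map ψ ψ ∘ₗ Coalgebra.comul = Coalgebra.comul ∘ₗ ψ)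
    (hS : ∀ s : S, act (Coalgebra.counit (R := k) ∘ₗ ψ) s = s) (g : Module.Dual k C) (s : S) :
    let _ := RightComodule.corestrict ψ hψ hS
    act g s = act (g ∘ₗ ψ) s :=
  rslice_lTensor _ _ _

theorem map_act_of_comul {ψ : D →ₗ[k] C}
    (hψ : TensorProduct.map ψ ψ ∘ₗ Coalgebra.comul = Coalgebra.comul ∘ₗ ψ) (g : Module.Dual k C)
    (x : D) : ψ (act (g ∘ₗ ψ) x) = act g (ψ x) := by
  have e : ψ ∘ₗ rslice D (g ∘ₗ ψ) = rslice C g ∘ₗ TensorProduct.map ψ ψ := by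
    ext; simp
  refine (LinearMap.congr_fun e _).trans ?_
  exact congrArg (rslice C g) (LinearMap.congr_fun hψ x)

theorem finite_comodHom_of_comp_injective {P P' : Type u}
    [AddCommGroup P] [Module k P] [AddCommGroup P'] [Module k P'] [RightComodule k D P]
    [RightComodule k C P'] [RightComodule k C S] [Module.Finite k (comodHom k C S P')]
    (j : P →ₗ[k] P') (hj : ∀ h ∈ comodHom k D S P, j ∘ₗ h ∈ comodHom k C S P')
    (hinj : ∀ h ∈ comodHom k D S P, j ∘ₗ h = 0 → h = 0) :
    Module.Finite k (comodHom k D S P) := by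
  let J : comodHom k D S P →ₗ[k] comodHom k C S P' :=
    { toFun := fun h => ⟨j ∘ₗ h.1, hj h.1 h.2⟩
      map_add' := fun a b => Subtype.ext (LinearMap.comp_add a.1 b.1 j)
      map_smul' := fun c a => Subtype.ext (LinearMap.comp_smul j c a.1) }
  exact Module.Finite.of_injective J ((injective_iff_map_eq_zero J).2 fun h hh =>
    Subtype.ext (hinj h.1 h.2 (congrArg Subtype.val hh)))

/-- Corestriction along `ψ` makes `S` a `C`-comodule, and `hdual` keeps it simple. Composition with
the induced map `D / N → C / N'` is injective on morphisms from `S`: by `hN'`, `ε ∘ ψ` annihilates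
the kernel of that map, yet it acts as the identity on `S`. The map `ψ` need not preserve the
counit, so projections of a direct sum are covered as well as inclusions. -/
theorem finite_comodHom_of_corestrict (hC : IsRightStrictlyQuasiFinite k C) (ψ : D →ₗ[k] C)
    (hψ : TensorProduct.map ψ ψ ∘ₗ Coalgebra.comul = Coalgebra.comul ∘ₗ ψ)
    (hS : IsSimpleComodule k D S)
    (hψS : ∀ s : S, act (Coalgebra.counit (R := k) ∘ₗ ψ) s = s)
    (hdual : ∀ f : Module.Dual k D, ∃ g : Module.Dual k C, ∀ s : S, act f s = act (g ∘ₗ ψ) s)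
    (N : Subcomodule k D D) (N' : Subcomodule k C C)
    (hN : N.toSubmodule ≤ N'.toSubmodule.comap ψ)
    (hN' : ∀ x, ψ x ∈ N'.toSubmodule →
      act (Coalgebra.counit (R := k) ∘ₗ ψ) x ∈ N.toSubmodule) :
    Module.Finite k (comodHom k D S (D ⧸ N.toSubmodule)) := by
  let _ := RightComodule.corestrict ψ hψ hψS
  have hS' : IsSimpleComodule k C S := by
    refine ⟨hS.1, fun X => hS.2 (Subcomodule.ofAct X.toSubmodule fun f m hm => ?_)⟩
    obtain ⟨g, hg⟩ := hdual f
    rw [hg, ← act_corestrict ψ hψ hψS]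
    exact X.act_mem g hm
  have hfin := hC N' S hS'
  let j := N.toSubmodule.mapQ N'.toSubmodule ψ hN
  have hj : ∀ h ∈ comodHom k D S (D ⧸ N.toSubmodule),
      j ∘ₗ h ∈ comodHom k C S (C ⧸ N'.toSubmodule) := by
    intro h hh
    refine mem_comodHom_iff.2 fun g s => ?_
    rw [act_corestrict ψ hψ hψS, LinearMap.comp_apply, comodHom.map_act hh, LinearMap.comp_apply]
    obtain ⟨x, hx⟩ := N.toSubmodule.mkQ_surjective (h s)
    rw [← hx, N.act_mkQ]
    change N'.toSubmodule.mkQ (ψ _) = act g (N'.toSubmodule.mkQ (ψ x))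
    rw [N'.act_mkQ, map_act_of_comul hψ]
  refine finite_comodHom_of_comp_injective j hj fun h hh hjh => LinearMap.ext fun s => ?_
  have h0 : j (h s) = 0 := LinearMap.congr_fun hjh s
  rw [LinearMap.zero_apply, ← hψS s, comodHom.map_act hh]
  obtain ⟨x, hx⟩ := N.toSubmodule.mkQ_surjective (h s)
  rw [← hx] at h0 ⊢
  rw [N.act_mkQ]
  exact (Submodule.Quotient.mk_eq_zero _).2 (hN' x ((Submodule.Quotient.mk_eq_zero _).1 h0))

/-! ### Subcoalgebras of strictly quasi-finite coalgebras -/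

/-- A subcomodule of a subcoalgebra, as a subcomodule of the whole coalgebra. -/
def Subcoalgebra.mapSubcomodule (A : Subcoalgebra k C)
    (X : Subcomodule k A.toSubmodule A.toSubmodule) : Subcomodule k C C :=
  .ofAct (X.toSubmodule.map A.toSubmodule.subtype) fun f _ => by
    rintro ⟨x, hx, rfl⟩
    exact ⟨_, X.act_mem (f ∘ₗ A.toSubmodule.subtype) hx, map_act_of_comul A.map_comp_comul f x⟩

theorem IsRightStrictlyQuasiFinite.subcoalgebra (hC : IsRightStrictlyQuasiFinite k C)
    (A : Subcoalgebra k C) : IsRightStrictlyQuasiFinite k A.toSubmodule := by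
  intro N S _ _ _ hS
  refine finite_comodHom_of_corestrict hC A.toSubmodule.subtype A.map_comp_comul hS
    (fun s => act_counit s) (fun f => ?_) N (A.mapSubcomodule N) (fun x hx => ⟨x, hx, rfl⟩) ?_
  · obtain ⟨g, hg⟩ := f.exists_extend
    exact ⟨g, fun s => by rw [hg]⟩
  · rintro x ⟨y, hy, hyx⟩
    rw [← Subtype.ext hyx]
    exact N.act_mem _ hy

end Corestriction

/-! ### Direct sums of strictly quasi-finite coalgebras -/

section DirectSum

variable {k : Type u} [Field k] {Λ : Type u} [DecidableEq Λ] {C : Λ → Type u}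
  [∀ i, AddCommGroup (C i)] [∀ i, Module k (C i)] [∀ i, Coalgebra k (C i)]
  {S : Type u} [AddCommGroup S] [Module k S] [RightComodule k (Π₀ i, C i) S]

/-- The counit of a summand, extended by zero to the direct sum. -/
noncomputable def componentCounit (k : Type u) [Field k] {C : Λ → Type u}
    [∀ i, AddCommGroup (C i)] [∀ i, Module k (C i)] [∀ i, Coalgebra k (C i)] (i : Λ) :
    Module.Dual k (Π₀ i, C i) :=
  Coalgebra.counit (R := k) (A := C i) ∘ₗ DFinsupp.lapply i

theorem componentCounit_comp_lsingle (i j : Λ) :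
    componentCounit k i ∘ₗ DFinsupp.lsingle j =
      if j = i then Coalgebra.counit (R := k) (A := C j) else 0 := by
  ext c
  rcases eq_or_ne j i with rfl | h
  · simp [componentCounit]
  · simp [componentCounit, DFinsupp.single_apply, h]

theorem rslice_map {V W E F : Type u} [AddCommGroup V] [Module k V] [AddCommGroup W] [Module k W]
    [AddCommGroup E] [Module k E] [AddCommGroup F] [Module k F] (a : V →ₗ[k] W) (b : E →ₗ[k] F)
    (f : Module.Dual k F) (t : V ⊗[k] E) :
    rslice W f (TensorProduct.map a b t) = a (rslice V (f ∘ₗ b) t) := by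
  have e : rslice W f ∘ₗ TensorProduct.map a b = a ∘ₗ rslice V (f ∘ₗ b) := by ext; simp
  exact LinearMap.congr_fun e t

theorem lslice_map {V W E F : Type u} [AddCommGroup V] [Module k V] [AddCommGroup W] [Module k W]
    [AddCommGroup E] [Module k E] [AddCommGroup F] [Module k F] (a : V →ₗ[k] W) (b : E →ₗ[k] F)
    (f : Module.Dual k W) (t : V ⊗[k] E) :
    lslice F f (TensorProduct.map a b t) = b (lslice E (f ∘ₗ a) t) := by
  have e : lslice F f ∘ₗ TensorProduct.map a b = b ∘ₗ lslice E (f ∘ₗ a) := by ext; simp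
  exact LinearMap.congr_fun e t

theorem rslice_componentCounit (i : Λ) (x : Π₀ i, C i) :
    rslice _ (componentCounit k i) (Coalgebra.comul (R := k) x) = DFinsupp.single i (x i) := by
  have : rslice _ (componentCounit k i) ∘ₗ Coalgebra.comul (R := k) =
      DFinsupp.lsingle i ∘ₗ DFinsupp.lapply (R := k) (M := C) i := by
    refine DFinsupp.lhom_ext' fun j => LinearMap.ext fun c => ?_
    simp only [LinearMap.comp_apply, DFinsupp.lsingle_apply, DFinsupp.comul_single, rslice_map,
      componentCounit_comp_lsingle]
    rcases eq_or_ne j i with rfl | h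
    · have := act_counit (k := k) (C := C j) c
      rw [act_apply] at this
      simp only [if_true, DFinsupp.lapply_apply, DFinsupp.single_eq_same]
      exact congrArg _ this
    · simp [h, rslice, DFinsupp.single_apply]
  exact LinearMap.congr_fun this x

theorem lslice_componentCounit (i : Λ) (x : Π₀ i, C i) :
    lslice _ (componentCounit k i) (Coalgebra.comul (R := k) x) = DFinsupp.single i (x i) := by
  have : lslice _ (componentCounit k i) ∘ₗ Coalgebra.comul (R := k) =
      DFinsupp.lsingle i ∘ₗ DFinsupp.lapply (R := k) (M := C) i := by
    refine DFinsupp.lhom_ext' fun j => LinearMap.ext fun c => ?_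
    simp only [LinearMap.comp_apply, DFinsupp.lsingle_apply, DFinsupp.comul_single, lslice_map,
      componentCounit_comp_lsingle]
    rcases eq_or_ne j i with rfl | h
    · simp [lslice_counit_comul]
    · simp [h, lslice, DFinsupp.single_apply]
  exact LinearMap.congr_fun this x

/-- With `componentCounit_conv`, this shows that the component counits are central idempotents of
the dual algebra. -/
theorem conv_componentCounit (i : Λ) (f : Module.Dual k (Π₀ i, C i)) :
    conv f (componentCounit k i) = f ∘ₗ DFinsupp.lsingle i ∘ₗ DFinsupp.lapply i := by
  refine LinearMap.ext fun x => ?_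
  have e : LinearMap.mul' k k ∘ₗ TensorProduct.map f (componentCounit k (C := C) i) =
      f ∘ₗ rslice (Π₀ i, C i) (componentCounit k (C := C) i) :=
    TensorProduct.ext' fun a b => by simp [mul_comm]
  refine (LinearMap.congr_fun e _).trans ?_
  rw [LinearMap.comp_apply, rslice_componentCounit]
  rfl

theorem componentCounit_conv (i : Λ) (f : Module.Dual k (Π₀ i, C i)) :
    conv (componentCounit k i) f = f ∘ₗ DFinsupp.lsingle i ∘ₗ DFinsupp.lapply i := by
  refine LinearMap.ext fun x => ?_
  have e : LinearMap.mul' k k ∘ₗ TensorProduct.map (componentCounit k (C := C) i) f =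
      f ∘ₗ lslice (Π₀ i, C i) (componentCounit k (C := C) i) :=
    TensorProduct.ext' fun a b => by simp
  refine (LinearMap.congr_fun e _).trans ?_
  rw [LinearMap.comp_apply, lslice_componentCounit]
  rfl

/-- Allowing every larger `F'` lets the finite sets of two summands be merged in an induction. -/
theorem exists_counit_eq_sum (x : Π₀ i, C i) : ∃ F : Finset Λ, ∀ F' : Finset Λ, F ⊆ F' →
    Coalgebra.counit (R := k) x = ∑ i ∈ F', componentCounit k i x := by
  induction x using DFinsupp.induction with
  | h0 => exact ⟨∅, fun F' _ => by simp⟩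
  | ha i b f _ _ ih =>
    obtain ⟨F, hF⟩ := ih
    refine ⟨insert i F, fun F' hF' => ?_⟩
    have hsum : ∑ j ∈ F', componentCounit k j (DFinsupp.single i b) =
        Coalgebra.counit (R := k) b := by
      rw [Finset.sum_eq_single_of_mem i (hF' (Finset.mem_insert_self i F))]
      · simp [componentCounit]
      · intro j _ hj
        simp [componentCounit, DFinsupp.single_apply, hj.symm]
    simp only [map_add, Finset.sum_add_distrib, hsum,
      ← hF F' ((Finset.subset_insert i F).trans hF'), DFinsupp.counit_single]

theorem exists_rslice_counit_eq_sum {V : Type u} [AddCommGroup V] [Module k V]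
    (t : V ⊗[k] (Π₀ i, C i)) : ∃ F : Finset Λ, ∀ F' : Finset Λ, F ⊆ F' →
    rslice V (Coalgebra.counit (R := k)) t = ∑ i ∈ F', rslice V (componentCounit k i) t := by
  induction t with
  | zero => exact ⟨∅, fun F' _ => by simp⟩
  | tmul v x =>
    obtain ⟨F, hF⟩ := exists_counit_eq_sum (k := k) x
    exact ⟨F, fun F' h => by simp [hF F' h, Finset.sum_smul]⟩
  | add a b ha hb =>
    obtain ⟨F, hF⟩ := ha
    obtain ⟨G, hG⟩ := hb
    refine ⟨F ∪ G, fun F' h => ?_⟩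
    simp only [map_add, Finset.sum_add_distrib, hF F' (Finset.union_subset_left h),
      hG F' (Finset.union_subset_right h)]

/-- The component counits sum to the identity on each element, so one of them acts nontrivially.
Being central, it is an endomorphism, injective by simplicity; an injective idempotent is the
identity. -/
theorem IsSimpleComodule.exists_componentCounit (hS : IsSimpleComodule k (Π₀ i, C i) S) :
    ∃ i, ∀ s : S, act (componentCounit k (C := C) i) s = s := by
  obtain ⟨s, hs⟩ := @exists_ne S hS.1 0
  obtain ⟨i, hi⟩ : ∃ i, act (componentCounit k (C := C) i) s ≠ 0 := by
    by_contra! hc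
    obtain ⟨F, hF⟩ := exists_rslice_counit_eq_sum
      (RightComodule.coact (k := k) (C := Π₀ i, C i) s)
    apply hs
    rw [← act_counit (k := k) (C := Π₀ i, C i) s, act_apply, hF F subset_rfl]
    exact Finset.sum_eq_zero fun i _ => hc i
  have hmem : act (componentCounit k (C := C) i) ∈ comodHom k (Π₀ i, C i) S S :=
    mem_comodHom_iff.2 fun f m => by
      rw [act_act, act_act, conv_componentCounit, componentCounit_conv]
  have hinj := hS.injective hmem fun h => hi (by rw [h, LinearMap.zero_apply])
  refine ⟨i, fun s => hinj ?_⟩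
  have e : componentCounit k (C := C) i ∘ₗ DFinsupp.lsingle i ∘ₗ DFinsupp.lapply i =
      componentCounit k i := LinearMap.ext fun x => by simp [componentCounit]
  rw [act_act, conv_componentCounit, e]

theorem isRightStrictlyQuasiFinite_dfinsupp (hC : ∀ i, IsRightStrictlyQuasiFinite k (C i)) :
    IsRightStrictlyQuasiFinite k (Π₀ i, C i) := by
  intro N S _ _ _ hS
  obtain ⟨i, hi⟩ := hS.exists_componentCounit
  have hN' (x : Π₀ i, C i) (hx : x ∈ N.toSubmodule) :
      DFinsupp.lsingle (R := k) i (x i) ∈ N.toSubmodule := by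
    have := N.act_mem (componentCounit k i) hx
    rwa [act_apply, show RightComodule.coact x = Coalgebra.comul (R := k) x from rfl,
      rslice_componentCounit] at this
  -- Since `N` is stable under the projection to the `i`-th summand, this preimage is also the image
  -- of `N` under that projection.
  let N' : Subcomodule k (C i) (C i) :=
    .ofAct (N.toSubmodule.comap (DFinsupp.lsingle i)) fun f c hc => by
      rw [Submodule.mem_comap] at hc ⊢
      have := N.act_mem (f ∘ₗ DFinsupp.lapply i) hc
      rw [act_apply, show RightComodule.coact (DFinsupp.lsingle (R := k) i c) =
        Coalgebra.comul (R := k) (DFinsupp.single i c) from rfl, DFinsupp.comul_single,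
        rslice_map] at this
      have e : (f ∘ₗ DFinsupp.lapply i) ∘ₗ DFinsupp.lsingle i = f := by
        ext; simp
      rwa [e] at this
  refine finite_comodHom_of_corestrict (hC i) (DFinsupp.lapply i)
    (DFinsupp.comul_comp_lapply k Λ C i).symm hS hi (fun f => ?_) N N' hN' (fun x hx => ?_)
  · refine ⟨f ∘ₗ DFinsupp.lsingle i, fun s => ?_⟩
    conv_lhs => rw [← hi s, act_act, conv_componentCounit]
    rfl
  · rw [show Coalgebra.counit ∘ₗ DFinsupp.lapply i = componentCounit k i from rfl, act_apply,
      show RightComodule.coact x = Coalgebra.comul (R := k) x from rfl, rslice_componentCounit]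
    exact hx

end DirectSum

/-! ### Coefficients of comodules -/

section Coefficients

variable {k C S M N : Type u} [Field k] [AddCommGroup C] [Module k C] [Coalgebra k C]
  [AddCommGroup S] [Module k S] [RightComodule k C S]
  [AddCommGroup M] [Module k M] [RightComodule k C M]
  [AddCommGroup N] [Module k N] [RightComodule k C N]

/-- The coefficients of `M` lie in the subspace `D` of `C`. -/
def CoeffIn (D : Submodule k C) (M : Type u) [AddCommGroup M] [Module k M]
    [RightComodule k C M] : Prop :=
  ∀ (φ : Module.Dual k M) (m : M), toC (C := C) φ m ∈ D

theorem CoeffIn.of_surjective {D : Submodule k C} (h : CoeffIn D M) {q : M →ₗ[k] N}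
    (hq : q ∈ comodHom k C M N) (hs : Function.Surjective q) : CoeffIn D N := by
  intro φ n
  obtain ⟨m, rfl⟩ := hs n
  rw [toC_comp hq]
  exact h _ m

theorem CoeffIn.of_injective {D : Submodule k C} (h : CoeffIn D N) {i : M →ₗ[k] N}
    (hi : i ∈ comodHom k C M N) (hinj : Function.Injective i) : CoeffIn D M := by
  intro φ m
  obtain ⟨g, hg⟩ := LinearMap.exists_leftInverse_of_injective i (LinearMap.ker_eq_bot.2 hinj)
  have e : (φ ∘ₗ g) ∘ₗ i = φ := by rw [LinearMap.comp_assoc, hg, LinearMap.comp_id]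
  rw [← e, ← toC_comp hi]
  exact h _ _

theorem Subcoalgebra.toC_mem (D : Subcoalgebra k C) (φ : Module.Dual k C) {c : C}
    (hc : c ∈ D.toSubmodule) : toC φ c ∈ D.toSubmodule := by
  rw [← Submodule.Quotient.mk_eq_zero]
  have h := (D.mkQ_comul c hc).2
  have h' := lslice_lTensor D.toSubmodule.mkQ φ (Coalgebra.comul (R := k) c)
  rw [h, map_zero] at h'
  exact h'.symm

/-- A subcoalgebra as a right subcomodule. -/
def Subcoalgebra.toSubcomodule (D : Subcoalgebra k C) : Subcomodule k C C :=
  .ofAct D.toSubmodule fun f c hc => by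
    rw [← Submodule.Quotient.mk_eq_zero]
    have h := (D.mkQ_comul c hc).1
    have h' := rslice_rTensor D.toSubmodule.mkQ f (Coalgebra.comul (R := k) c)
    rw [h, map_zero] at h'
    exact h'.symm

theorem Subcoalgebra.coeffIn (D : Subcoalgebra k C) :
    CoeffIn D.toSubmodule D.toSubcomodule.toSubmodule := by
  intro φ c
  obtain ⟨g, hg⟩ := LinearMap.exists_leftInverse_of_injective D.toSubcomodule.toSubmodule.subtype
    (Submodule.ker_subtype _)
  have e : (φ ∘ₗ g) ∘ₗ D.toSubcomodule.toSubmodule.subtype = φ := by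
    rw [LinearMap.comp_assoc, hg, LinearMap.comp_id]
  rw [← e, ← toC_comp D.toSubcomodule.subtype_mem]
  exact D.toC_mem _ c.2

/-- Let `W` be the previous wedge power. If `g(S)` is not inside `W`, simplicity makes `S → C / W`
injective. The wedge condition then forces the coaction of `S` into `S ⊗ A`, and contraction with `ε
∘ g` gives `g(S) ⊆ A`. -/
theorem Subcoalgebra.range_le_of_range_le_wedgePow (A : Subcoalgebra k C)
    (hS : IsSimpleComodule k C S) {g : S →ₗ[k] C} (hg : g ∈ comodHom k C S C) (h0 : g ≠ 0) :
    ∀ n, LinearMap.range g ≤ wedgePow A.toSubmodule n → LinearMap.range g ≤ A.toSubmodule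
  | 0, h => absurd (LinearMap.range_eq_bot.1 (le_bot_iff.1 h)) h0
  | 1, h => h
  | n + 2, h => by
    let W : Subcoalgebra k C := ⟨wedgePow A.toSubmodule (n + 1), A.comul_mem_wedgePow (n + 1)⟩
    have hp := comodHom.comp W.toSubcomodule.mkQ_mem hg
    by_cases hW : W.toSubcomodule.toSubmodule.mkQ ∘ₗ g = 0
    · refine A.range_le_of_range_le_wedgePow hS hg h0 (n + 1) ?_
      rintro _ ⟨s, rfl⟩
      exact (Submodule.Quotient.mk_eq_zero _).1 (LinearMap.congr_fun hW s)
    · have hinj := hS.injective hp hW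
      rintro _ ⟨s, rfl⟩
      have h1 : TensorProduct.map W.toSubcomodule.toSubmodule.mkQ A.toSubmodule.mkQ
          (Coalgebra.comul (R := k) (g s)) = 0 := h ⟨s, rfl⟩
      have h2 : Coalgebra.comul (R := k) (g s) =
          g.rTensor C (RightComodule.coact (k := k) (C := C) s) := LinearMap.congr_fun hg s
      have h3 : A.toSubmodule.mkQ.lTensor S (RightComodule.coact (k := k) (C := C) s) = 0 := by
        apply Module.Flat.rTensor_preserves_injective_linearMap (M := C ⧸ A.toSubmodule) _ hinj
        rw [map_zero, ← LinearMap.comp_apply, LinearMap.rTensor_comp_lTensor,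
          ← LinearMap.map_comp_rTensor, LinearMap.comp_apply, ← h2]
        exact h1
      rw [← toC_counit_comp hg, toC_apply, ← Submodule.Quotient.mk_eq_zero,
        ← Submodule.mkQ_apply, ← lslice_lTensor, h3, map_zero]

/-- A simple comodule with coefficients in `A_∞` embeds in `A`. -/
theorem Subcoalgebra.exists_hom_of_coeffIn (A : Subcoalgebra k C) (hS : IsSimpleComodule k C S)
    (h : CoeffIn A.infty.toSubmodule S) :
    ∃ g ∈ comodHom k C S A.toSubcomodule.toSubmodule, g ≠ 0 := by
  obtain ⟨s, hs⟩ := @exists_ne S hS.1 0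
  obtain ⟨φ, hφ⟩ : ∃ φ : Module.Dual k S, φ s ≠ 0 := by
    by_contra! hc
    exact hs ((Module.forall_dual_apply_eq_zero_iff k s).1 hc)
  have hg := _root_.toC_mem (C := C) φ
  have hgs : toC (C := C) φ s ≠ 0 := fun h0 => hφ (by rw [← counit_toC (C := C), h0, map_zero])
  have h0 : toC (C := C) φ ≠ 0 := fun h0 => hgs (by rw [h0, LinearMap.zero_apply])
  have hmono : Monotone (wedgePow A.toSubmodule) := monotone_nat_of_le_succ A.wedgePow_le_succ
  -- The stage containing one nonzero value contains the whole image, by simplicity of `S`.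
  obtain ⟨n, hn⟩ := (Submodule.mem_iSup_of_directed _ hmono.directed_le).1 (h φ s)
  let W : Subcoalgebra k C := ⟨wedgePow A.toSubmodule n, A.comul_mem_wedgePow n⟩
  have hle : LinearMap.range (toC (C := C) φ) ≤ wedgePow A.toSubmodule n := by
    rcases hS.2 (W.toSubcomodule.comap hg) with h1 | h1
    · have : s ∈ (W.toSubcomodule.comap hg).toSubmodule := hn
      rw [h1] at this
      exact absurd ((Submodule.mem_bot k).1 this) hs
    · rintro _ ⟨x, rfl⟩
      have : x ∈ (W.toSubcomodule.comap hg).toSubmodule := by rw [h1]; trivial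
      exact this
  obtain ⟨j, hj, hj'⟩ := comodHom.exists_lift A.toSubcomodule.subtype_mem
    A.toSubcomodule.toSubmodule.injective_subtype hg (by
      rw [Submodule.range_subtype]
      exact A.range_le_of_range_le_wedgePow hS hg h0 n hle)
  refine ⟨j, hj, ?_⟩
  rintro rfl
  exact h0 (by rw [← hj', LinearMap.comp_zero])

theorem Subcoalgebra.mapSubcomodule_le (A : Subcoalgebra k C)
    (X : Subcomodule k A.toSubmodule A.toSubmodule) :
    (A.mapSubcomodule X).toSubmodule ≤ A.toSubmodule := Submodule.map_subtype_le _ _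

/-- Divide a strictly descending chain by its intersection `N`. The simple subcomodules of all terms
embed in `A`, so in the quasi-finite `C / N` they lie in one finite-dimensional `F`. The traces on
`F` stabilise, and a simple subcomodule then survives in every term although the terms now meet in
zero. -/
theorem isArtinianComodule_infty (hC : IsRightStrictlyQuasiFinite k C) (A : Subcoalgebra k C)
    [Module.Finite k A.toSubmodule] :
    IsArtinianComodule k A.infty.toSubmodule A.infty.toSubmodule := by
  refine ⟨RelEmbedding.wellFounded_iff_isEmpty.2 ⟨fun X => ?_⟩⟩
  let Y : ℕ → Subcomodule k C C := fun n => A.infty.mapSubcomodule (X n)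
  have hX : StrictAnti fun n => (X n) := strictAnti_nat_of_succ_lt fun n =>
    X.map_rel_iff.2 (Nat.lt_succ_self n)
  have hY : StrictAnti fun n => (Y n).toSubmodule := fun a b hab =>
    Submodule.map_strictMono_of_injective A.infty.toSubmodule.injective_subtype (hX hab)
  let N := Subcomodule.iInf Y
  have hNY (n : ℕ) : N.toSubmodule ≤ (Y n).toSubmodule := iInf_le _ n
  have : Module.Finite k A.toSubcomodule.toSubmodule := ‹Module.Finite k A.toSubmodule›
  obtain ⟨F, _, hF⟩ := (hC N).exists_finite_range_le A.toSubcomodule.toSubmodule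
  let Z : ℕ → Subcomodule k C (C ⧸ N.toSubmodule) := fun n => (Y n).map N.mkQ_mem
  have hZ : Antitone fun n => (Z n).toSubmodule := fun a b hab =>
    Submodule.map_mono (hY.antitone hab)
  have hZF : Monotone fun n => OrderDual.toDual ((Z n).toSubmodule.comap F.subtype) :=
    fun a b hab => Submodule.comap_mono (hZ hab)
  obtain ⟨n, hn⟩ := WellFoundedGT.monotone_chain_condition ⟨_, hZF⟩
  have hZ0 : (Z n).toSubmodule ≠ ⊥ := fun h => by
    refine (hY (Nat.lt_succ_self n)).not_ge (le_trans (fun y hy => ?_) (hNY (n + 1)))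
    have : N.toSubmodule.mkQ y ∈ (Z n).toSubmodule := ⟨y, hy, rfl⟩
    rw [h] at this
    exact (Submodule.Quotient.mk_eq_zero _).1 this
  obtain ⟨T, hTZ, hT⟩ := (Z n).exists_simple_le hZ0
  have hcoeff : CoeffIn A.infty.toSubmodule T.toSubmodule := by
    intro φ t
    obtain ⟨g, hg⟩ := φ.exists_extend
    obtain ⟨y, hy, hyt⟩ := hTZ t.2
    rw [← hg, ← toC_comp T.subtype_mem]
    change toC g (t : C ⧸ N.toSubmodule) ∈ _
    rw [← hyt, toC_comp N.mkQ_mem]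
    exact A.infty.toC_mem _ (A.infty.mapSubcomodule_le _ hy)
  obtain ⟨g, hg, hg0⟩ := A.exists_hom_of_coeffIn hT hcoeff
  have hTF := hF T.toSubmodule hT g hg hg0 _ T.subtype_mem
  rw [Submodule.range_subtype] at hTF
  obtain ⟨t, ht⟩ := @exists_ne T.toSubmodule hT.1 0
  refine ht (Subtype.ext ?_)
  have hmem (m : ℕ) : (t : C ⧸ N.toSubmodule) ∈ (Z m).toSubmodule := by
    rcases le_total m n with h | h
    · exact hZ h (hTZ t.2)
    · have h1 : (⟨t, hTF t.2⟩ : F) ∈ (Z n).toSubmodule.comap F.subtype := hTZ t.2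
      have h2 : (Z n).toSubmodule.comap F.subtype = (Z m).toSubmodule.comap F.subtype := hn m h
      rw [h2] at h1
      exact h1
  obtain ⟨c, hc⟩ := N.toSubmodule.mkQ_surjective (t : C ⧸ N.toSubmodule)
  rw [← hc, Submodule.coe_zero]
  -- Each `Y m` contains `N`, so a representative `c` of `t` lies in every `Y m`, hence in `N`.
  refine (Submodule.Quotient.mk_eq_zero _).2 ((Submodule.mem_iInf _).2 fun m => ?_)
  obtain ⟨y, hy, hyt⟩ := hmem m
  have : c - y ∈ N.toSubmodule := by
    rw [← Submodule.Quotient.mk_eq_zero, Submodule.Quotient.mk_sub, sub_eq_zero]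
    exact (hc.trans hyt.symm)
  simpa using Submodule.add_mem _ (hNY m this) hy

/-! ### Semiperfect coalgebras -/

/-- The cyclic subcomodule generated by a lift of a nonzero element already maps onto `S`, so
smallness of the kernel makes it everything. -/
theorem IsProjectiveCover.finite {f : M →ₗ[k] S} (hf : IsProjectiveCover k C f)
    (hS : IsSimpleComodule k C S) : Module.Finite k M := by
  obtain ⟨-, hmem, hsurj, hsmall⟩ := hf
  obtain ⟨s, hs⟩ := @exists_ne S hS.1 0
  obtain ⟨m, rfl⟩ := hsurj s
  let X := Subcomodule.cyclic (k := k) C m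
  have h := comodHom.comp hmem X.subtype_mem
  have hX := hS.surjective h fun h0 => hs (LinearMap.congr_fun h0 ⟨m, Subcomodule.mem_cyclic m⟩)
  have htop := hsmall X <| by
    rw [eq_top_iff]
    intro y _
    obtain ⟨x, hx⟩ := hX (f y)
    have : y - x ∈ LinearMap.ker f := by
      rw [LinearMap.mem_ker, map_sub, ← hx]
      exact sub_self _
    simpa using Submodule.add_mem_sup x.2 this
  have : Module.Finite k (⊤ : Submodule k M) := htop ▸ Subcomodule.finite_cyclic (C := C) m
  exact Module.Finite.of_surjective _ (Submodule.topEquiv (R := k) (M := M)).surjective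

/-- The space of coefficients of a comodule. -/
noncomputable def coeffSpace (k C M : Type u) [Field k] [AddCommGroup C] [Module k C]
    [Coalgebra k C] [AddCommGroup M] [Module k M] [RightComodule k C M] : Subcomodule k C C :=
  .iSup fun φ : Module.Dual k M => Subcomodule.range (toC_mem φ)

theorem range_le_coeffSpace {h : M →ₗ[k] C} (hh : h ∈ comodHom k C M C) :
    LinearMap.range h ≤ (coeffSpace k C M).toSubmodule := by
  have e : toC (Coalgebra.counit (R := k) (A := C) ∘ₗ h) = h :=
    LinearMap.ext fun m => toC_counit_comp hh m
  conv_lhs => rw [← e]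
  exact le_iSup (fun φ : Module.Dual k M => LinearMap.range (toC (C := C) φ)) _

instance finite_coeffSpace [Module.Finite k M] : Module.Finite k (coeffSpace k C M).toSubmodule := by
  let L : Module.Dual k M →ₗ[k] M →ₗ[k] C :=
    { toFun := fun φ => toC φ
      map_add' := fun a b => by simp [toC, lslice, LinearMap.rTensor_add, LinearMap.add_comp,
        LinearMap.comp_add]
      map_smul' := fun c a => by simp [toC, lslice, LinearMap.rTensor_smul, LinearMap.smul_comp,
        LinearMap.comp_smul] }
  refine Submodule.finiteDimensional_of_le (S₂ := LinearMap.range (TensorProduct.lift L)) ?_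
  refine iSup_le fun φ => ?_
  rintro _ ⟨m, rfl⟩
  exact ⟨φ ⊗ₜ m, TensorProduct.lift.tmul _ _⟩

theorem IsRightSemiperfect.exists_finite (hC : IsRightSemiperfect k C) (l : List (ComodCat k C))
    (hl : ∀ L ∈ l, IsSimpleComodule k C L.carrier) :
    ∃ B : Subcomodule k C C, Module.Finite k B.toSubmodule ∧ ∀ L ∈ l,
      ∃ (P : ComodCat k C) (f : P.carrier →ₗ[k] L.carrier), IsProjectiveCover k C f ∧
        ∀ h ∈ comodHom k C P.carrier C, LinearMap.range h ≤ B.toSubmodule := by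
  induction l with
  | nil => exact ⟨.zero, inferInstanceAs (Module.Finite k (⊥ : Submodule k C)), by simp⟩
  | cons L l ih =>
    obtain ⟨B, hB, hB'⟩ := ih fun L' h => hl L' (List.mem_cons_of_mem _ h)
    have hL := hl L List.mem_cons_self
    obtain ⟨P, _, _, _, f, hf⟩ := hC L.carrier hL
    have := hf.finite hL
    refine ⟨B.sup (coeffSpace k C P), inferInstanceAs (Module.Finite k
      (B.toSubmodule ⊔ (coeffSpace k C P).toSubmodule : Submodule k C)), fun L' hL' => ?_⟩
    rcases List.mem_cons.1 hL' with rfl | h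
    · exact ⟨⟨P⟩, f, hf, fun h hh => (range_le_coeffSpace hh).trans le_sup_right⟩
    · obtain ⟨P', f', hf', h'⟩ := hB' L' h
      exact ⟨P', f', hf', fun h hh => (h' h hh).trans le_sup_left⟩

/-- Let `B` contain the images in `C` of the projective covers of the simple types of `A`. If a
cyclic `X ⊆ A_∞` were not inside `B`, then `X / (X ∩ B)` would have a simple quotient of such a
type. Its cover lifts to `X`, but every morphism from the cover to `C` lands in `B`, so the covering
map would be zero. -/
theorem finite_infty_of_semiperfect (hC : IsRightSemiperfect k C) (A : Subcoalgebra k C)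
    [Module.Finite k A.toSubmodule] : Module.Finite k A.infty.toSubmodule := by
  have : Module.Finite k A.toSubcomodule.toSubmodule := ‹Module.Finite k A.toSubmodule›
  obtain ⟨l, hl, hl'⟩ := exists_simples_of_finite (k := k) (C := C) _
    A.toSubcomodule.toSubmodule rfl
  obtain ⟨B, _, hB⟩ := hC.exists_finite l hl
  refine Submodule.finiteDimensional_of_le (S₂ := B.toSubmodule) fun c hc => ?_
  let X := Subcomodule.cyclic (k := k) C c
  have hX : X.toSubmodule ≤ A.infty.toSubcomodule.toSubmodule :=
    A.infty.toSubcomodule.cyclic_le hc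
  let Y := B.comap X.subtype_mem
  suffices h : Y.toSubmodule = ⊤ by
    have : (⟨c, Subcomodule.mem_cyclic c⟩ : X.toSubmodule) ∈ Y.toSubmodule := by
      rw [h]; trivial
    exact this
  by_contra hY
  have := Submodule.Quotient.nontrivial_iff.2 hY
  obtain ⟨Z, hZ⟩ := exists_simple_quotient (k := k) (C := C) (M := X.toSubmodule ⧸ Y.toSubmodule)
  have hπ := comodHom.comp Z.mkQ_mem Y.mkQ_mem
  have hπs : Function.Surjective (Z.toSubmodule.mkQ ∘ₗ Y.toSubmodule.mkQ) :=
    Z.toSubmodule.mkQ_surjective.comp Y.toSubmodule.mkQ_surjective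
  have hcoeff := (A.infty.coeffIn.of_injective (Subcomodule.inclusion_mem hX)
    (Submodule.inclusion_injective hX)).of_surjective hπ hπs
  obtain ⟨g, hg, hg0⟩ := A.exists_hom_of_coeffIn hZ hcoeff
  obtain ⟨L, hL, j, hj, hj0⟩ := hl' _ hZ g hg hg0
  obtain ⟨i, hi, hij, hji⟩ := hZ.exists_inverse (hl L hL) hj hj0
  obtain ⟨P, f, ⟨hproj, hf, hfs, -⟩, hPB⟩ := hB L hL
  obtain ⟨q, hq, hq'⟩ := hproj _ _ _ hπ hπs _ (comodHom.comp hi hf)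
  have hr := hPB _ (comodHom.comp X.subtype_mem hq)
  have h0 : i ∘ₗ f = 0 := by
    rw [← hq']
    refine LinearMap.ext fun p => ?_
    have : q p ∈ Y.toSubmodule := hr ⟨p, rfl⟩
    simp only [LinearMap.comp_apply, LinearMap.zero_apply]
    rw [Submodule.mkQ_apply Y.toSubmodule, (Submodule.Quotient.mk_eq_zero _).2 this, map_zero]
  have hi0 : i = 0 := (LinearMap.cancel_right hfs).1 (h0.trans (LinearMap.zero_comp _).symm)
  have := hZ.1
  obtain ⟨z, hz⟩ := exists_ne (0 : (X.toSubmodule ⧸ Y.toSubmodule) ⧸ Z.toSubmodule)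
  refine hz ((LinearMap.congr_fun hij z).symm.trans ?_)
  rw [hi0, LinearMap.zero_comp, LinearMap.zero_apply]

end Coefficients

/-! ### The category of comodules -/

section Category

variable {k C D : Type u} [Field k] [AddCommGroup C] [Module k C] [Coalgebra k C]
  [AddCommGroup D] [Module k D] [Coalgebra k D]

namespace ComodCat

theorem hom_ext {X Y : ComodCat k C} {f g : X ⟶ Y} (h : f.1 = g.1) : f = g := Subtype.ext h

/-- A morphism of comodules as a morphism in the category. -/
def ofHom {M N : Type u} [AddCommGroup M] [Module k M] [RightComodule k C M] [AddCommGroup N]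
    [Module k N] [RightComodule k C N] (f : M →ₗ[k] N) (hf : f ∈ comodHom k C M N) :
    (⟨M⟩ : ComodCat k C) ⟶ ⟨N⟩ := ⟨f, hf⟩

theorem mono_iff_injective {X Y : ComodCat k C} (f : X ⟶ Y) :
    Mono f ↔ Function.Injective f.1 := by
  constructor
  · intro h
    let K := Subcomodule.ker f.2
    have h0 : (ofHom K.toSubmodule.subtype K.subtype_mem ≫ f : ⟨K.toSubmodule⟩ ⟶ Y) =
        (0 : ⟨K.toSubmodule⟩ ⟶ X) ≫ f :=
      hom_ext (LinearMap.ext fun x => (x.2 : f.1 x = 0).trans (map_zero f.1).symm)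
    have h1 := congrArg Subtype.val ((cancel_mono f).1 h0)
    refine (injective_iff_map_eq_zero f.1).2 fun x hx => ?_
    exact LinearMap.congr_fun h1 (⟨x, hx⟩ : K.toSubmodule)
  · intro h
    exact ⟨fun a b hab => hom_ext ((LinearMap.cancel_left h).1 (congrArg Subtype.val hab))⟩

theorem epi_iff_surjective {X Y : ComodCat k C} (f : X ⟶ Y) :
    Epi f ↔ Function.Surjective f.1 := by
  constructor
  · intro h
    let R := Subcomodule.range f.2
    have h0 : (f ≫ ofHom R.toSubmodule.mkQ R.mkQ_mem : X ⟶ ⟨Y.carrier ⧸ R.toSubmodule⟩) =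
        f ≫ (0 : Y ⟶ ⟨Y.carrier ⧸ R.toSubmodule⟩) :=
      hom_ext (LinearMap.ext fun x => (Submodule.Quotient.mk_eq_zero _).2 ⟨x, rfl⟩)
    have h1 := congrArg Subtype.val ((cancel_epi f).1 h0)
    intro y
    exact (Submodule.Quotient.mk_eq_zero R.toSubmodule).1 (LinearMap.congr_fun h1 y)
  · intro h
    exact ⟨fun a b hab => hom_ext ((LinearMap.cancel_right h).1 (congrArg Subtype.val hab))⟩

/-- A description by arrows alone, hence one that an equivalence of categories preserves. -/
theorem isSimple_iff (X : ComodCat k C) : IsSimpleComodule k C X.carrier ↔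
    𝟙 X ≠ 0 ∧ ∀ (Y : ComodCat k C) (f : Y ⟶ X), Mono f → f = 0 ∨ Epi f := by
  constructor
  · intro h
    refine ⟨fun h0 => ?_, fun Y f _ => ?_⟩
    · obtain ⟨x, hx⟩ := @exists_ne _ h.1 0
      exact hx (LinearMap.congr_fun (congrArg Subtype.val h0) x)
    · by_cases h0 : f = 0
      · exact Or.inl h0
      · exact Or.inr ((epi_iff_surjective f).2 (h.surjective f.2 fun h1 => h0 (hom_ext h1)))
  · rintro ⟨h0, h⟩
    refine ⟨not_subsingleton_iff_nontrivial.1 fun hs => h0 (hom_ext (LinearMap.ext fun x =>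
      Subsingleton.elim _ _)), fun N => ?_⟩
    rcases h _ (ofHom N.toSubmodule.subtype N.subtype_mem)
      ((mono_iff_injective _).2 N.toSubmodule.injective_subtype) with h1 | h1
    · left
      rw [← Submodule.range_subtype N.toSubmodule]
      exact LinearMap.range_eq_bot.2 (congrArg Subtype.val h1)
    · right
      rw [← Submodule.range_subtype N.toSubmodule]
      exact LinearMap.range_eq_top.2 ((epi_iff_surjective _).1 h1)

theorem isSimple_obj (e : ComodCat k D ≌ ComodCat k C) [e.functor.PreservesZeroMorphisms]
    {X : ComodCat k D} (hX : IsSimpleComodule k D X.carrier) :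
    IsSimpleComodule k C (e.functor.obj X).carrier := by
  rw [isSimple_iff] at hX ⊢
  obtain ⟨h0, h⟩ := hX
  refine ⟨fun h1 => h0 (e.functor.map_injective (by simpa using h1)), fun Y f _ => ?_⟩
  rcases h _ (e.inverse.map f ≫ e.unitIso.inv.app X) inferInstance with h1 | h1
  · left
    rw [← Limits.zero_comp (f := e.unitIso.inv.app X), cancel_mono] at h1
    exact e.inverse.map_injective (by rw [h1, Functor.map_zero])
  · right
    have : e.inverse.map f = (e.inverse.map f ≫ e.unitIso.inv.app X) ≫ e.unitIso.hom.app X := by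
      simp
    have : Epi (e.inverse.map f) := by
      rw [this]
      exact epi_comp _ _
    exact e.inverse.epi_of_epi_map this

end ComodCat

/-- The direct sum of two comodules. -/
noncomputable instance RightComodule.prod {M N : Type u} [AddCommGroup M] [Module k M]
    [RightComodule k C M] [AddCommGroup N] [Module k N] [RightComodule k C N] :
    RightComodule k C (M × N) where
  coact := LinearMap.coprod ((LinearMap.inl k M N).rTensor C ∘ₗ coact)
    ((LinearMap.inr k M N).rTensor C ∘ₗ coact)
  coassoc := by
    -- Maps out of `M × N` are compared on the two inclusions, so one computation for a general `i`
    -- serves both.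
    have key : ∀ (V : Type u) [AddCommGroup V] [Module k V] [RightComodule k C V]
        (i : V →ₗ[k] M × N) (ρ : M × N →ₗ[k] (M × N) ⊗[k] C), ρ ∘ₗ i = i.rTensor C ∘ₗ coact →
        ((TensorProduct.assoc k (M × N) C C).toLinearMap ∘ₗ ρ.rTensor C ∘ₗ ρ) ∘ₗ i =
        ((Coalgebra.comul (R := k) (A := C)).lTensor (M × N) ∘ₗ ρ) ∘ₗ i := by
      intro V _ _ _ i ρ h
      have e : (TensorProduct.assoc k (M × N) C C).toLinearMap ∘ₗ (i.rTensor C).rTensor C =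
          i.rTensor (C ⊗[k] C) ∘ₗ (TensorProduct.assoc k V C C).toLinearMap := by
        exact TensorProduct.ext_threefold fun _ _ _ => by simp
      rw [LinearMap.comp_assoc, LinearMap.comp_assoc, h, ← LinearMap.comp_assoc coact,
        ← LinearMap.rTensor_comp, h, LinearMap.rTensor_comp, LinearMap.comp_assoc,
        ← LinearMap.comp_assoc _ _ (TensorProduct.assoc k (M × N) C C).toLinearMap, e,
        LinearMap.comp_assoc, coassoc, ← LinearMap.comp_assoc, LinearMap.rTensor_comp_lTensor,
        LinearMap.comp_assoc, h, ← LinearMap.comp_assoc coact, LinearMap.lTensor_comp_rTensor]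
    apply LinearMap.prod_ext
    · exact key M _ _ (LinearMap.coprod_inl _ _)
    · exact key N _ _ (LinearMap.coprod_inr _ _)
  lTensor_counit_comp_coact := by
    have key : ∀ (V : Type u) [AddCommGroup V] [Module k V] [RightComodule k C V]
        (i : V →ₗ[k] M × N) (ρ : M × N →ₗ[k] (M × N) ⊗[k] C), ρ ∘ₗ i = i.rTensor C ∘ₗ coact →
        ((Coalgebra.counit (R := k) (A := C)).lTensor (M × N) ∘ₗ ρ) ∘ₗ i =
        (TensorProduct.mk k (M × N) k).flip 1 ∘ₗ i := by
      intro V _ _ _ i ρ h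
      rw [LinearMap.comp_assoc, h, ← LinearMap.comp_assoc, LinearMap.lTensor_comp_rTensor,
        ← LinearMap.rTensor_comp_lTensor, LinearMap.comp_assoc, lTensor_counit_comp_coact]
      exact LinearMap.ext fun v => by simp
    apply LinearMap.prod_ext
    · exact key M _ _ (LinearMap.coprod_inl _ _)
    · exact key N _ _ (LinearMap.coprod_inr _ _)

/-- Linearity of a functor records scalars only; additivity of an equivalence is deduced from its
preserving binary products. -/
instance : Limits.HasBinaryBiproducts (ComodCat k C) where
  has_binary_biproduct X Y := by
    have hl : LinearMap.inl k X.carrier Y.carrier ∈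
        comodHom k C X.carrier (X.carrier × Y.carrier) := LinearMap.coprod_inl _ _
    have hr : LinearMap.inr k X.carrier Y.carrier ∈
        comodHom k C Y.carrier (X.carrier × Y.carrier) := LinearMap.coprod_inr _ _
    have hf : LinearMap.fst k X.carrier Y.carrier ∈
        comodHom k C (X.carrier × Y.carrier) X.carrier := by
      refine LinearMap.prod_ext ?_ ?_
      · rw [LinearMap.comp_assoc, LinearMap.comp_assoc, (hl : _ = _), ← LinearMap.comp_assoc _ _
          (LinearMap.rTensor C _), ← LinearMap.rTensor_comp, LinearMap.fst_comp_inl,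
          LinearMap.rTensor_id]
        rfl
      · rw [LinearMap.comp_assoc, LinearMap.comp_assoc, (hr : _ = _), ← LinearMap.comp_assoc _ _
          (LinearMap.rTensor C _), ← LinearMap.rTensor_comp, LinearMap.fst_comp_inr,
          LinearMap.rTensor_zero, LinearMap.zero_comp, LinearMap.comp_zero]
    have hs : LinearMap.snd k X.carrier Y.carrier ∈
        comodHom k C (X.carrier × Y.carrier) Y.carrier := by
      refine LinearMap.prod_ext ?_ ?_
      · rw [LinearMap.comp_assoc, LinearMap.comp_assoc, (hl : _ = _), ← LinearMap.comp_assoc _ _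
          (LinearMap.rTensor C _), ← LinearMap.rTensor_comp, LinearMap.snd_comp_inl,
          LinearMap.rTensor_zero, LinearMap.zero_comp, LinearMap.comp_zero]
      · rw [LinearMap.comp_assoc, LinearMap.comp_assoc, (hr : _ = _), ← LinearMap.comp_assoc _ _
          (LinearMap.rTensor C _), ← LinearMap.rTensor_comp, LinearMap.snd_comp_inr,
          LinearMap.rTensor_id]
        rfl
    let b : Limits.BinaryBicone X Y :=
      { pt := ⟨X.carrier × Y.carrier⟩
        fst := ⟨_, hf⟩
        snd := ⟨_, hs⟩
        inl := ⟨_, hl⟩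
        inr := ⟨_, hr⟩
        inl_fst := ComodCat.hom_ext (LinearMap.fst_comp_inl _ _ _)
        inl_snd := ComodCat.hom_ext (LinearMap.snd_comp_inl _ _ _)
        inr_fst := ComodCat.hom_ext (LinearMap.fst_comp_inr _ _ _)
        inr_snd := ComodCat.hom_ext (LinearMap.snd_comp_inr _ _ _) }
    exact Limits.hasBinaryBiproduct_of_total b (ComodCat.hom_ext (LinearMap.ext fun x =>
      Prod.ext (add_zero _) (zero_add _)))

/-! ### Transport along an equivalence -/

theorem finite_hom_of_faithful {A B : Type*} [Category* A] [Category* B] [Preadditive A]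
    [Preadditive B] [CategoryTheory.Linear k A] [CategoryTheory.Linear k B] (F : A ⥤ B)
    [F.Additive] [F.Linear k] [F.Faithful] {X Y : A} [Module.Finite k (F.obj X ⟶ F.obj Y)] :
    Module.Finite k (X ⟶ Y) :=
  Module.Finite.of_injective (F.mapLinearMap k) F.map_injective

theorem finite_hom_of_full {A B : Type*} [Category* A] [Category* B] [Preadditive A]
    [Preadditive B] [CategoryTheory.Linear k A] [CategoryTheory.Linear k B] (F : A ⥤ B)
    [F.Additive] [F.Linear k] [F.Full] {X Y : A} [Module.Finite k (X ⟶ Y)] {T : B}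
    (i : T ≅ F.obj X) : Module.Finite k (T ⟶ F.obj Y) := by
  refine Module.Finite.of_surjective (Linear.leftComp k (F.obj Y) i.hom ∘ₗ F.mapLinearMap k)
    fun f => ?_
  obtain ⟨g, hg⟩ := F.map_surjective (i.inv ≫ f)
  exact ⟨g, by simp [hg]⟩

/-- A morphism `S → C` is determined by its composite with the counit, and the dual of the
finite-dimensional `S` is finite-dimensional. -/
theorem isQuasiFinite_self : IsQuasiFinite k C C := by
  intro S _ _ _ hS
  have := hS.finite
  let E : comodHom k C S C →ₗ[k] Module.Dual k S :=
    { toFun := fun f => Coalgebra.counit ∘ₗ f.1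
      map_add' := fun f g => LinearMap.comp_add f.1 g.1 _
      map_smul' := fun a f => LinearMap.comp_smul _ a f.1 }
  refine Module.Finite.of_injective E fun f g hfg => Subtype.ext (LinearMap.ext fun s => ?_)
  have h : Coalgebra.counit ∘ₗ f.1 = Coalgebra.counit ∘ₗ g.1 := hfg
  rw [← toC_counit_comp f.2, ← toC_counit_comp g.2, h]

/-- The image of the regular comodule of `D` need not be that of `C`, but it is quasi-finite because
`D` is. It is therefore strictly quasi-finite, and quotients of `D` go to quotients of it. -/
theorem IsRightStrictlyQuasiFinite.of_moritaTakeuchiEquivalent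
    (hC : IsRightStrictlyQuasiFinite k C) (h : MoritaTakeuchiEquivalent k D C) :
    IsRightStrictlyQuasiFinite k D := by
  obtain ⟨e, he⟩ := h
  have : e.functor.Additive := Functor.additive_of_preserves_binary_products _
  have hqf : IsQuasiFinite k C (e.functor.obj ⟨D⟩).carrier := by
    intro T _ _ _ hT
    have : Module.Finite k (e.inverse.obj ⟨T⟩ ⟶ ⟨D⟩) :=
      isQuasiFinite_self _ (ComodCat.isSimple_obj e.symm (X := ⟨T⟩) hT)
    exact finite_hom_of_full e.functor (Y := ⟨D⟩) (e.counitIso.symm.app ⟨T⟩)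
  have hsqf := isStrictlyQuasiFinite_iff.1 (hC.isStrictlyQuasiFinite hqf)
  intro X S _ _ _ hS
  have hπ : Epi (ComodCat.ofHom X.toSubmodule.mkQ X.mkQ_mem) :=
    (ComodCat.epi_iff_surjective _).2 X.toSubmodule.mkQ_surjective
  have hFπ := (ComodCat.epi_iff_surjective (e.functor.map
    (ComodCat.ofHom X.toSubmodule.mkQ X.mkQ_mem))).1 inferInstance
  have : Module.Finite k (e.functor.obj ⟨S⟩ ⟶ e.functor.obj ⟨D ⧸ X.toSubmodule⟩) :=
    hsqf _ (ComodCat.isSimple_obj e (X := ⟨S⟩) hS) _ _ (e.functor.map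
      (ComodCat.ofHom X.toSubmodule.mkQ X.mkQ_mem)).2 hFπ
  exact finite_hom_of_faithful e.functor (X := ⟨S⟩) (Y := ⟨D ⧸ X.toSubmodule⟩)

end Category

theorem mainTheorem9 (k : Type u) [Field k] :
    (∀ (C : Type u) [AddCommGroup C] [Module k C] [Coalgebra k C],
      IsRightStrictlyQuasiFinite k C →
        ∀ D : Subcoalgebra k C, IsRightStrictlyQuasiFinite k D.toSubmodule) ∧
    (∀ (C : Type u) [AddCommGroup C] [Module k C] [Coalgebra k C] (A : Subcoalgebra k C),
      Module.Finite k A.toSubmodule →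
        (IsRightStrictlyQuasiFinite k C →
          IsArtinianComodule k A.infty.toSubmodule A.infty.toSubmodule) ∧
        (IsRightSemiperfect k C → Module.Finite k A.infty.toSubmodule)) ∧
    (∀ (C D : Type u) [AddCommGroup C] [Module k C] [Coalgebra k C]
      [AddCommGroup D] [Module k D] [Coalgebra k D],
      IsRightStrictlyQuasiFinite k C → MoritaTakeuchiEquivalent k D C →
        IsRightStrictlyQuasiFinite k D) ∧
    (∀ (Λ : Type u) [DecidableEq Λ] (C : Λ → Type u) [∀ i, AddCommGroup (C i)]
      [∀ i, Module k (C i)] [∀ i, Coalgebra k (C i)],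
      (∀ i, IsRightStrictlyQuasiFinite k (C i)) →
        IsRightStrictlyQuasiFinite k (Π₀ i, C i)) :=
  ⟨fun _ _ _ _ hC D => hC.subcoalgebra D,
    fun _ _ _ _ A _ => ⟨fun hC => isArtinianComodule_infty hC A,
      fun hC => finite_infty_of_semiperfect hC A⟩,
    fun _ _ _ _ _ _ _ _ hC h => hC.of_moritaTakeuchiEquivalent h,
    fun _ _ _ _ _ _ hC => isRightStrictlyQuasiFinite_dfinsupp hC⟩
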